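/- The ground field is $\mathbb{C}$. All objects are $(\mathbb{Z}\times\mathbb{Z})$-bigraded; Koszul signs follow the first degree only. A bidifferential algebra is a bigraded unital associative algebra with two differentials $d,d'$ (square-zero graded derivations) of degrees $(1,0)$ and $(-1,0)$. On $A\otimes B$ one takes the product $(x\otimes y)(x'\otimes y')=(-1)^{|y||x'|}xx'\otimes yy'$, the differentials $x\otimes y\mapsto dx\otimes y+(-1)^{|x|}x\otimes dy$ (likewise for $d'$) and the symmetry $\tau(x\otimes y)=(-1)^{|x||y|}y\otimes x$. For a finite set $I$, let $\mathsf{R}(I)$ be the unital graded-commutative algebra generated by elements $a_{i,j}=-a_{j,i}$ of degree $(0,1)$ and $b_{i,j}=-b_{j,i}$ of degree $(1,1)$, for all pairs of distinct $i,j\in I$, modulo, for pairwise different indices, $$a_{i,j}^2=0,\qquad a_{i,j}a_{j,k}+a_{j,k}a_{k,i}+a_{k,i}a_{i,j}=0,$$ $$b_{i,j}a_{j,k}+b_{j,k}a_{k,i}+b_{k,i}a_{i,j}+a_{i,j}b_{j,k}+a_{j,k}b_{k,i}+a_{k,i}b_{i,j}=0,$$ $$a_{i_0,i_1}b_{i_1,i_2}\cdots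 b_{i_n,i_0}=0,\qquad b_{i_0,i_1}b_{i_1,i_2}\cdots b_{i_n,i_0}=0\qquad(n\ge 1),$$ $$\sum b_{i,j}a_{j,k}b_{k,\ell}=0,\qquad \sum b_{i,j}b_{j,k}b_{k,\ell}=0,$$ where each of the last two sums has 12 terms, one for each permutation of $i,j,k,\ell$ up to reversal. **Proposition.** There is exactly one structure consisting of * differentials $d,d'$ on each $\mathsf{R}(I)$ with $d(a_{i,j})=b_{i,j}$, $d(b_{i,j})=0$, $d'(b_{i,j})=a_{i,j}$, $d'(a_{i,j})=0$, making $\mathsf{R}(I)$ a bidifferential algebra; * for each bijection $\sigma:I\to I'$ a morphism of bidifferential algebras $\mathsf{R}(I)\to\mathsf{R}(I')$ with $a_{i,j}\mapsto a_{\sigma(i),\sigma(j)}$, $b_{i,j}\mapsto b_{\sigma(i),\sigma(j)}$; * for all finite sets $I,J$ a morphism of bidifferential algebras $\Theta^{\star}_{I,J}:\mathsf{R}(I\sqcup J)\to\mathsf{R}(I\sqcup\{\star\})\otimes\mathsf{R}(J)$ with, for $c=a$ and $c=b$, $$\Theta^{\star}_{I,J}(c_{i,j})=\begin{cases}c_{i,j}\otimes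 1&\text{if }i,j\in I,\\ 1\otimes c_{i,j}&\text{if }i,j\in J,\\ c_{i,\star}\otimes 1&\text{if }i\in I\text{ and }j\in J;\end{cases}$$ * a morphism of bidifferential algebras $\varepsilon:\mathsf{R}(\{\star\})\to\mathbb{C}$ (with $\mathbb{C}$ in degree $(0,0)$ and zero differentials), such that $\mathsf{R}$ is a Hopf cooperad of bidifferential algebras, that is: $\mathsf{R}$ is a functor on finite sets and bijections, the maps $\Theta$ are natural in $I$ and $J$, the maps $\Theta$ are coassociative, $$(\Theta^{\star}_{I,J\sqcup\{\#\}}\otimes \mathrm{Id})\circ\Theta^{\#}_{I\sqcup J,K}=(\mathrm{Id}\otimes\Theta^{\#}_{J,K})\circ\Theta^{\star}_{I,J\sqcup K},$$ $$(\Theta^{\star}_{I\sqcup\{\#\},J}\otimes \mathrm{Id})\circ\Theta^{\#}_{I\sqcup J,K}=(\mathrm{Id}\otimes\tau)\circ(\Theta^{\#}_{I\sqcup\{\star\},K}\otimes \mathrm{Id})\circ\Theta^{\star}_{I\sqcup K,J}$$ for all finite sets $I,J,K$, where $\tau$ is the symmetry $\mathsf{R}(K)\otimes\mathsf{R}(J)\to\mathsf{R}(J)\otimes\mathsf{R}(K)$,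 and $\varepsilon$ is a counit: $(\varepsilon\otimes\mathrm{Id})\circ\Theta^{\star}_{\emptyset,J}=\mathrm{Id}$, and $(\mathrm{Id}\otimes\varepsilon)\circ\Theta^{\star}_{I,\{j\}}$ is the relabelling of $j$ by $\star$. -/

import Mathlib

open scoped TensorProduct DirectSum

universe u

noncomputable section

/-! ### Bigraded algebras, bidifferentials, Koszul tensor products -/

/-- The action of `ℤ × ℤ` on signs through its first coordinate. It makes the sign
`(-1) ^ (m * n)` in Mathlib's graded tensor product equal to `(-1) ^ (m.1 * n.1)`:
the Koszul rule for the first degree only. -/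
instance bidegreeSignModule : Module (ℤ × ℤ) (Additive ℤˣ) :=
  Module.compHom (Additive ℤˣ) (RingHom.fst ℤ ℤ)

theorem neg_one_uzpow_bidegree (m : ℤ × ℤ) :
    ((-1 : ℤˣ) ^ m : ℤˣ) = (-1 : ℤˣ) ^ m.1 := rfl

/-- A unital associative `(ℤ × ℤ)`-graded algebra over `ℂ`. -/
structure BigradedAlg : Type (u + 1) where
  carrier : Type u
  [ring : Ring carrier]
  [algebra : Algebra ℂ carrier]
  gr : ℤ × ℤ → Submodule ℂ carrier
  [graded : GradedAlgebra gr]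

namespace BigradedAlg

instance : CoeSort BigradedAlg.{u} (Type u) := ⟨carrier⟩

attribute [instance] ring algebra graded

/-- The vector space `A ⊗ B` with the product
`(x ⊗ y) (x' ⊗ y') = (-1) ^ (p' q) (x x') ⊗ (y y')`,
`q` and `p'` the first degrees of `y` and `x'`. -/
abbrev Tensor (A B : BigradedAlg.{u}) : Type u := GradedTensorProduct ℂ A.gr B.gr

/-- The identity between the ordinary and the Koszul tensor product, as a linear map. -/
abbrev unTensor (A B : BigradedAlg.{u}) : A.Tensor B →ₗ[ℂ] A ⊗[ℂ] B :=
  (GradedTensorProduct.of ℂ A.gr B.gr).symm.toLinearMap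

/-- The symmetry `x ⊗ y ↦ (-1) ^ (p q) y ⊗ x`, `p` and `q` the first degrees of `x` and `y`. -/
def tau (A B : BigradedAlg.{u}) : A ⊗[ℂ] B →ₗ[ℂ] B ⊗[ℂ] A :=
  unTensor B A ∘ₗ (GradedTensorProduct.comm A.gr B.gr).toLinearMap ∘ₗ
    (GradedTensorProduct.of ℂ A.gr B.gr).toLinearMap

/-- The component of bidegree `n` of `A ⊗ B`. -/
def tensorGr (A B : BigradedAlg.{u}) (n : ℤ × ℤ) : Submodule ℂ (A ⊗[ℂ] B) :=
  Submodule.span ℂ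
    {t | ∃ (k l : ℤ × ℤ) (x : A) (y : B), x ∈ A.gr k ∧ y ∈ B.gr l ∧ k + l = n ∧ t = x ⊗ₜ[ℂ] y}

/-- The linear involution of `A` that multiplies the elements of bidegree `(p, q)` by
`(-1) ^ p`. -/
def koszulSign (A : BigradedAlg.{u}) : A →ₗ[ℂ] A :=
  DirectSum.toModule ℂ (ℤ × ℤ) A
      (fun n => ((n.1.negOnePow : ℤ) : ℂ) • (A.gr n).subtype) ∘ₗ
    (DirectSum.decomposeLinearEquiv A.gr).toLinearMap

theorem koszulSign_apply (A : BigradedAlg.{u}) (n : ℤ × ℤ) (x : A) (hx : x ∈ A.gr n) :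
    A.koszulSign x = ((n.1.negOnePow : ℤ) : ℂ) • x := by
  lift x to A.gr n using hx
  rw [koszulSign, LinearMap.comp_apply, LinearEquiv.coe_coe,
    DirectSum.decomposeLinearEquiv_apply, DirectSum.decompose_coe, ← DirectSum.lof_eq_of ℂ,
    DirectSum.toModule_lof]
  rfl

end BigradedAlg

/-- Two differentials of degrees `(1, 0)` and `(-1, 0)` on a bigraded algebra, both
(graded) derivations. With these, the algebra is a bidifferential algebra. -/
@[ext]
structure Bidifferential (A : BigradedAlg.{u}) where
  d : A →ₗ[ℂ] A
  dPrime : A →ₗ[ℂ] A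
  d_mem : ∀ (p q : ℤ) (x : A), x ∈ A.gr (p, q) → d x ∈ A.gr (p + 1, q)
  dPrime_mem : ∀ (p q : ℤ) (x : A), x ∈ A.gr (p, q) → dPrime x ∈ A.gr (p - 1, q)
  d_mul : ∀ (p q : ℤ) (x y : A), x ∈ A.gr (p, q) →
    d (x * y) = d x * y + ((p.negOnePow : ℤ) : ℂ) • (x * d y)
  dPrime_mul : ∀ (p q : ℤ) (x y : A), x ∈ A.gr (p, q) →
    dPrime (x * y) = dPrime x * y + ((p.negOnePow : ℤ) : ℂ) • (x * dPrime y)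
  d_d : ∀ x : A, d (d x) = 0
  dPrime_dPrime : ∀ x : A, dPrime (dPrime x) = 0

/-- The differential `x ⊗ y ↦ d x ⊗ y + (-1) ^ p x ⊗ d y` of `A ⊗ B`, for `x` of first
degree `p`, made of odd differentials of `A` and of `B`. -/
def tensorD (A B : BigradedAlg.{u}) (dA : A →ₗ[ℂ] A) (dB : B →ₗ[ℂ] B) :
    A ⊗[ℂ] B →ₗ[ℂ] A ⊗[ℂ] B :=
  TensorProduct.map dA LinearMap.id + TensorProduct.map A.koszulSign dB

/-! ### Bijections between finite sets

The set `I ⊔ J` is `I ⊕ J` and the set `I ⊔ {⋆}` is `Option I`, with `none` as `⋆`. -/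

/-- `(I ⊔ J) ⊔ {#} ≃ I ⊔ (J ⊔ {#})`. -/
def optionSumRight (I J : Type u) : Option (I ⊕ J) ≃ I ⊕ Option J where
  toFun
    | none => Sum.inr none
    | some (Sum.inl i) => Sum.inl i
    | some (Sum.inr j) => Sum.inr (some j)
  invFun
    | Sum.inr none => none
    | Sum.inl i => some (Sum.inl i)
    | Sum.inr (some j) => some (Sum.inr j)
  left_inv := by rintro (_ | _ | _) <;> rfl
  right_inv := by rintro (_ | _ | _) <;> rfl

/-- `(I ⊔ J) ⊔ {#} ≃ (I ⊔ {#}) ⊔ J`. -/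
def optionSumLeft (I J : Type u) : Option (I ⊕ J) ≃ Option I ⊕ J where
  toFun
    | none => Sum.inl none
    | some (Sum.inl i) => Sum.inl (some i)
    | some (Sum.inr j) => Sum.inr j
  invFun
    | Sum.inl none => none
    | Sum.inl (some i) => some (Sum.inl i)
    | Sum.inr j => some (Sum.inr j)
  left_inv := by rintro (_ | _ | _) <;> rfl
  right_inv := by rintro ((_ | _) | _) <;> rfl

/-- `(I ⊔ J) ⊔ K ≃ (I ⊔ K) ⊔ J`. -/
def sumRightComm (I J K : Type u) : (I ⊕ J) ⊕ K ≃ (I ⊕ K) ⊕ J where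
  toFun
    | Sum.inl (Sum.inl i) => Sum.inl (Sum.inl i)
    | Sum.inl (Sum.inr j) => Sum.inr j
    | Sum.inr k => Sum.inl (Sum.inr k)
  invFun
    | Sum.inl (Sum.inl i) => Sum.inl (Sum.inl i)
    | Sum.inr j => Sum.inl (Sum.inr j)
    | Sum.inl (Sum.inr k) => Sum.inr k
  left_inv := by rintro ((_ | _) | _) <;> rfl
  right_inv := by rintro ((_ | _) | _) <;> rfl

/-- `(I ⊔ {⋆}) ⊔ {#} ≃ (I ⊔ {#}) ⊔ {⋆}`. -/
def optionSwap (I : Type u) : Option (Option I) ≃ Option (Option I) where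
  toFun
    | none => some none
    | some none => none
    | some (some i) => some (some i)
  invFun
    | none => some none
    | some none => none
    | some (some i) => some (some i)
  left_inv := by rintro (_ | _ | _) <;> rfl
  right_inv := by rintro (_ | _ | _) <;> rfl

/-! ### Hopf cooperads of bidifferential algebras -/

/-- The structure of a (counital) Hopf cooperad of bidifferential algebras on a collection
`P` of bigraded algebras indexed by finite sets. -/
@[ext]
structure HopfCooperad (P : (I : Type u) → [Finite I] → BigradedAlg.{u}) where
  /-- the two differentials of each `P I` -/
  bidiff : (I : Type u) → [Finite I] → Bidifferential (P I)
  /-- the functor from finite sets and bijections to bidifferential algebras -/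
  map : {I I' : Type u} → [Finite I] → [Finite I'] → (I ≃ I') → (P I →ₐ[ℂ] P I')
  map_mem : ∀ {I I' : Type u} [Finite I] [Finite I'] (σ : I ≃ I') (n : ℤ × ℤ) (x : P I),
    x ∈ (P I).gr n → map σ x ∈ (P I').gr n
  map_d : ∀ {I I' : Type u} [Finite I] [Finite I'] (σ : I ≃ I') (x : P I),
    map σ ((bidiff I).d x) = (bidiff I').d (map σ x)
  map_dPrime : ∀ {I I' : Type u} [Finite I] [Finite I'] (σ : I ≃ I') (x : P I),
    map σ ((bidiff I).dPrime x) = (bidiff I').dPrime (map σ x)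
  map_refl : ∀ (I : Type u) [Finite I], map (Equiv.refl I) = AlgHom.id ℂ (P I)
  map_trans : ∀ {I I' I'' : Type u} [Finite I] [Finite I'] [Finite I'']
    (σ : I ≃ I') (ρ : I' ≃ I''), map (σ.trans ρ) = (map ρ).comp (map σ)
  /-- the cocomposition `P (I ⊔ J) → P (I ⊔ {⋆}) ⊗ P J`, a morphism of algebras -/
  cocomp : (I J : Type u) → [Finite I] → [Finite J] →
    (P (I ⊕ J) →ₐ[ℂ] (P (Option I)).Tensor (P J))
  cocomp_mem : ∀ (I J : Type u) [Finite I] [Finite J] (n : ℤ × ℤ) (x : P (I ⊕ J)),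
    x ∈ (P (I ⊕ J)).gr n →
      BigradedAlg.unTensor _ _ (cocomp I J x) ∈ BigradedAlg.tensorGr (P (Option I)) (P J) n
  cocomp_d : ∀ (I J : Type u) [Finite I] [Finite J] (x : P (I ⊕ J)),
    BigradedAlg.unTensor _ _ (cocomp I J ((bidiff (I ⊕ J)).d x)) =
      tensorD _ _ (bidiff (Option I)).d (bidiff J).d
        (BigradedAlg.unTensor _ _ (cocomp I J x))
  cocomp_dPrime : ∀ (I J : Type u) [Finite I] [Finite J] (x : P (I ⊕ J)),
    BigradedAlg.unTensor _ _ (cocomp I J ((bidiff (I ⊕ J)).dPrime x)) =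
      tensorD _ _ (bidiff (Option I)).dPrime (bidiff J).dPrime
        (BigradedAlg.unTensor _ _ (cocomp I J x))
  /-- naturality of the cocomposition with respect to bijections -/
  cocomp_natural : ∀ {I I' J J' : Type u} [Finite I] [Finite I'] [Finite J] [Finite J']
    (σ : I ≃ I') (ρ : J ≃ J'),
    BigradedAlg.unTensor _ _ ∘ₗ (cocomp I' J').toLinearMap ∘ₗ
        (map (Equiv.sumCongr σ ρ)).toLinearMap =
      TensorProduct.map (map (Equiv.optionCongr σ)).toLinearMap (map ρ).toLinearMap ∘ₗ
        BigradedAlg.unTensor _ _ ∘ₗ (cocomp I J).toLinearMap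
  /-- sequential coassociativity:
  `(Θ⋆_{I, J ⊔ #} ⊗ Id) ∘ Θ#_{I ⊔ J, K} = (Id ⊗ Θ#_{J, K}) ∘ Θ⋆_{I, J ⊔ K}` -/
  coassoc_seq : ∀ (I J K : Type u) [Finite I] [Finite J] [Finite K],
    (TensorProduct.assoc ℂ (P (Option I)) (P (Option J)) (P K)).toLinearMap ∘ₗ
        TensorProduct.map
          (BigradedAlg.unTensor _ _ ∘ₗ (cocomp I (Option J)).toLinearMap ∘ₗ
            (map (optionSumRight I J)).toLinearMap)
          LinearMap.id ∘ₗ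
        BigradedAlg.unTensor _ _ ∘ₗ (cocomp (I ⊕ J) K).toLinearMap =
      TensorProduct.map LinearMap.id
          (BigradedAlg.unTensor _ _ ∘ₗ (cocomp J K).toLinearMap) ∘ₗ
        BigradedAlg.unTensor _ _ ∘ₗ (cocomp I (J ⊕ K)).toLinearMap ∘ₗ
        (map (Equiv.sumAssoc I J K)).toLinearMap
  /-- parallel coassociativity:
  `(Θ⋆_{I ⊔ #, J} ⊗ Id) ∘ Θ#_{I ⊔ J, K} = (Id ⊗ τ) ∘ (Θ#_{I ⊔ ⋆, K} ⊗ Id) ∘ Θ⋆_{I ⊔ K, J}` -/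
  coassoc_par : ∀ (I J K : Type u) [Finite I] [Finite J] [Finite K],
    (TensorProduct.assoc ℂ (P (Option (Option I))) (P J) (P K)).toLinearMap ∘ₗ
        TensorProduct.map
          (BigradedAlg.unTensor _ _ ∘ₗ (cocomp (Option I) J).toLinearMap ∘ₗ
            (map (optionSumLeft I J)).toLinearMap)
          LinearMap.id ∘ₗ
        BigradedAlg.unTensor _ _ ∘ₗ (cocomp (I ⊕ J) K).toLinearMap =
      TensorProduct.map (map (optionSwap I)).toLinearMap (BigradedAlg.tau (P K) (P J)) ∘ₗ
        (TensorProduct.assoc ℂ (P (Option (Option I))) (P K) (P J)).toLinearMap ∘ₗ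
        TensorProduct.map
          (BigradedAlg.unTensor _ _ ∘ₗ (cocomp (Option I) K).toLinearMap ∘ₗ
            (map (optionSumLeft I K)).toLinearMap)
          LinearMap.id ∘ₗ
        BigradedAlg.unTensor _ _ ∘ₗ (cocomp (I ⊕ K) J).toLinearMap ∘ₗ
        (map (sumRightComm I J K)).toLinearMap
  /-- the counit, a morphism of bidifferential algebras from `P {⋆}` to the ground field
  (in degree `(0, 0)`, with zero differentials) -/
  counit : P PUnit.{u + 1} →ₐ[ℂ] ℂ
  counit_mem : ∀ (n : ℤ × ℤ) (x : P PUnit.{u + 1}), x ∈ (P PUnit.{u + 1}).gr n → n ≠ 0 →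
    counit x = 0
  counit_d : ∀ x : P PUnit.{u + 1}, counit ((bidiff PUnit.{u + 1}).d x) = 0
  counit_dPrime : ∀ x : P PUnit.{u + 1}, counit ((bidiff PUnit.{u + 1}).dPrime x) = 0
  /-- `(ε ⊗ Id) ∘ Θ_{∅, J} = Id` -/
  counit_left : ∀ (J : Type u) [Finite J],
    (TensorProduct.lid ℂ (P J)).toLinearMap ∘ₗ
        TensorProduct.map
          (counit.toLinearMap ∘ₗ
            (map ((Equiv.optionEquivSumPUnit PEmpty.{u + 1}).trans
              (Equiv.emptySum PEmpty.{u + 1} PUnit.{u + 1}))).toLinearMap)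
          LinearMap.id ∘ₗ
        BigradedAlg.unTensor _ _ ∘ₗ (cocomp PEmpty.{u + 1} J).toLinearMap =
      (map (Equiv.emptySum PEmpty.{u + 1} J)).toLinearMap
  /-- `(Id ⊗ ε) ∘ Θ_{I, {j}}` is the relabelling of `j` by `⋆` -/
  counit_right : ∀ (I : Type u) [Finite I],
    (TensorProduct.rid ℂ (P (Option I))).toLinearMap ∘ₗ
        TensorProduct.map LinearMap.id counit.toLinearMap ∘ₗ
        BigradedAlg.unTensor _ _ ∘ₗ (cocomp I PUnit.{u + 1}).toLinearMap =
      (map (Equiv.optionEquivSumPUnit.{u} I).symm).toLinearMap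

/-! ### The algebras `R I` -/

namespace RAlg

/-- Names of the generators `a i j` and `b i j`. (The generators with `i = j` vanish by the
antisymmetry relations, so that only pairs of distinct elements matter.) -/
inductive Gen (I : Type u) : Type u
  | a (i j : I) : Gen I
  | b (i j : I) : Gen I

/-- The bidegrees of the generators. -/
def Gen.deg {I : Type u} : Gen I → ℤ × ℤ
  | Gen.a _ _ => (0, 1)
  | Gen.b _ _ => (1, 1)

variable {I : Type u}

/-- The generator `a i j` in the free associative algebra. -/
def fa (i j : I) : FreeAlgebra ℂ (Gen I) := FreeAlgebra.ι ℂ (Gen.a i j)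

/-- The generator `b i j` in the free associative algebra. -/
def fb (i j : I) : FreeAlgebra ℂ (Gen I) := FreeAlgebra.ι ℂ (Gen.b i j)

/-- `bab i j k l = b i j * a j k * b k l`. -/
def bab (i j k l : I) : FreeAlgebra ℂ (Gen I) := fb i j * fa j k * fb k l

/-- `bbb i j k l = b i j * b j k * b k l`. -/
def bbb (i j k l : I) : FreeAlgebra ℂ (Gen I) := fb i j * fb j k * fb k l

/-- The sum of `f` over the permutations of `i, j, k, l` up to reversal. -/
def sum12 (f : I → I → I → I → FreeAlgebra ℂ (Gen I)) (i j k l : I) :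
    FreeAlgebra ℂ (Gen I) :=
  f i j k l + f i k j l + f i j l k + f i l j k + f i k l j + f i l k j +
    f j i k l + f j k i l + f j i l k + f j l i k + f k i j l + f k j i l

/-- The defining relations: antisymmetry of the generators, graded commutativity (`a` is even
and `b` is odd), and the relations that are specific to `R I`. In the cyclic relations, the
indices `c 0, ..., c n` are pairwise different, `n ≥ 1`, and `k + 1` is understood modulo
`n + 1`. -/
inductive Rel (I : Type u) : FreeAlgebra ℂ (Gen I) → FreeAlgebra ℂ (Gen I) → Prop
  | antisymm_a (i j : I) : Rel I (fa j i) (-fa i j)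
  | antisymm_b (i j : I) : Rel I (fb j i) (-fb i j)
  | comm_aa (i j k l : I) : Rel I (fa i j * fa k l) (fa k l * fa i j)
  | comm_ab (i j k l : I) : Rel I (fa i j * fb k l) (fb k l * fa i j)
  | comm_bb (i j k l : I) : Rel I (fb i j * fb k l) (-(fb k l * fb i j))
  | a_sq (i j : I) (hij : i ≠ j) : Rel I (fa i j * fa i j) 0
  | rel_aa (i j k : I) (hij : i ≠ j) (hjk : j ≠ k) (hki : k ≠ i) :
      Rel I (fa i j * fa j k + fa j k * fa k i + fa k i * fa i j) 0
  | rel_ab (i j k : I) (hij : i ≠ j) (hjk : j ≠ k) (hki : k ≠ i) :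
      Rel I (fb i j * fa j k + fb j k * fa k i + fb k i * fa i j +
        fa i j * fb j k + fa j k * fb k i + fa k i * fb i j) 0
  | cycle_abb (n : ℕ) (hn : 1 ≤ n) (c : Fin (n + 1) → I) (hc : Function.Injective c) :
      Rel I (fa (c 0) (c 1) *
        (List.ofFn fun k : Fin n => fb (c k.succ) (c (k.succ + 1))).prod) 0
  | cycle_bbb (n : ℕ) (hn : 1 ≤ n) (c : Fin (n + 1) → I) (hc : Function.Injective c) :
      Rel I (List.ofFn fun k : Fin (n + 1) => fb (c k) (c (k + 1))).prod 0
  | rel_bab (i j k l : I) (h : [i, j, k, l].Nodup) : Rel I (sum12 bab i j k l) 0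
  | rel_bbb (i j k l : I) (h : [i, j, k, l].Nodup) : Rel I (sum12 bbb i j k l) 0

/-- The underlying algebra of `R I`. -/
abbrev Carrier (I : Type u) : Type u := RingQuot (Rel I)

/-- The quotient map from the free algebra. -/
def mk (I : Type u) : FreeAlgebra ℂ (Gen I) →ₐ[ℂ] Carrier I := RingQuot.mkAlgHom ℂ (Rel I)

/-- The component of bidegree `n` of the free algebra: the span of the monomials of
bidegree `n`. -/
def freeGr (I : Type u) (n : ℤ × ℤ) : Submodule ℂ (FreeAlgebra ℂ (Gen I)) :=
  Submodule.span ℂ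
    {x | ∃ w : List (Gen I), (w.map Gen.deg).sum = n ∧ x = (w.map (FreeAlgebra.ι ℂ)).prod}

/-- The component of bidegree `n` of `R I`. -/
def gr (I : Type u) (n : ℤ × ℤ) : Submodule ℂ (Carrier I) :=
  (freeGr I n).map (mk I).toLinearMap

instance freeGr_gradedMonoid : SetLike.GradedMonoid (freeGr I) where
  one_mem := Submodule.subset_span ⟨[], by simp, by simp⟩
  mul_mem m n x y hx hy := by
    have h := Submodule.mul_mem_mul hx hy
    rw [freeGr, freeGr, Submodule.span_mul_span] at h
    refine Submodule.span_mono ?_ h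
    rintro _ ⟨_, ⟨w, hw, rfl⟩, _, ⟨v, hv, rfl⟩, rfl⟩
    exact ⟨w ++ v, by simp [hw, hv], by simp⟩

instance gr_gradedMonoid : SetLike.GradedMonoid (gr I) where
  one_mem := ⟨1, SetLike.GradedOne.one_mem, map_one (mk I)⟩
  mul_mem := by
    rintro m n _ _ ⟨x, hx, rfl⟩ ⟨y, hy, rfl⟩
    exact ⟨x * y, SetLike.GradedMul.mul_mem hx hy, map_mul (mk I) x y⟩

theorem ι_mem (g : Gen I) : FreeAlgebra.ι ℂ g ∈ freeGr I g.deg :=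
  Submodule.subset_span ⟨[g], by simp, by simp⟩

/-- The decomposition into homogeneous components, on the free algebra. -/
def preDecompose (I : Type u) : FreeAlgebra ℂ (Gen I) →ₐ[ℂ] ⨁ n, gr I n :=
  FreeAlgebra.lift ℂ fun g =>
    DirectSum.of (fun n => gr I n) g.deg ⟨mk I (FreeAlgebra.ι ℂ g), _, ι_mem g, rfl⟩

theorem preDecompose_apply (n : ℤ × ℤ) (x : FreeAlgebra ℂ (Gen I)) (hx : x ∈ freeGr I n) :
    preDecompose I x = DirectSum.of (fun n => gr I n) n ⟨mk I x, x, hx, rfl⟩ := by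
  have key : ∀ w : List (Gen I), ∀ (n : ℤ × ℤ) (h : (w.map Gen.deg).sum = n)
      (h' : mk I (w.map (FreeAlgebra.ι ℂ)).prod ∈ gr I n),
      preDecompose I (w.map (FreeAlgebra.ι ℂ)).prod =
        DirectSum.of (fun n => gr I n) n ⟨mk I (w.map (FreeAlgebra.ι ℂ)).prod, h'⟩ := by
    intro w
    induction w with
    | nil =>
      rintro n rfl h'
      simp only [List.map_nil, List.prod_nil, map_one]
      rfl
    | cons g w ih =>
      rintro n rfl h'
      have hw : mk I (w.map (FreeAlgebra.ι ℂ)).prod ∈ gr I (w.map Gen.deg).sum :=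
        ⟨_, Submodule.subset_span ⟨w, rfl, rfl⟩, rfl⟩
      simp only [List.map_cons, List.prod_cons, map_mul]
      rw [ih _ rfl hw, preDecompose, FreeAlgebra.lift_ι_apply, DirectSum.of_mul_of]
      rfl
  induction hx using Submodule.span_induction with
  | mem x h =>
    obtain ⟨w, hw, rfl⟩ := h
    exact key w n hw _
  | zero =>
    rw [map_zero, ← map_zero (DirectSum.of (fun n => gr I n) n)]
    congr 1
    exact Subtype.ext (map_zero (mk I)).symm
  | add x y hx hy h1 h2 =>
    rw [map_add, h1, h2, ← map_add]
    congr 1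
    exact Subtype.ext (map_add (mk I) x y).symm
  | smul c x hx h1 =>
    rw [map_smul, h1, ← DirectSum.lof_eq_of ℂ, ← DirectSum.lof_eq_of ℂ, ← map_smul]
    congr 1
    exact Subtype.ext (map_smul (mk I) c x).symm

theorem fa_mem (i j : I) : fa i j ∈ freeGr I (0, 1) := ι_mem (Gen.a i j)

theorem fb_mem (i j : I) : fb i j ∈ freeGr I (1, 1) := ι_mem (Gen.b i j)

theorem mul_mem_freeGr {m n k : ℤ × ℤ} {x y : FreeAlgebra ℂ (Gen I)} (hx : x ∈ freeGr I m)
    (hy : y ∈ freeGr I n) (h : m + n = k) : x * y ∈ freeGr I k :=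
  h ▸ SetLike.GradedMul.mul_mem hx hy

theorem sum12_mem {n : ℤ × ℤ} {f : I → I → I → I → FreeAlgebra ℂ (Gen I)}
    (hf : ∀ i j k l, f i j k l ∈ freeGr I n) (i j k l : I) : sum12 f i j k l ∈ freeGr I n := by
  unfold sum12
  repeat' apply Submodule.add_mem
  all_goals apply hf

/-- The relations are homogeneous. -/
theorem Rel.homogeneous {x y : FreeAlgebra ℂ (Gen I)} (h : Rel I x y) :
    ∃ n, x ∈ freeGr I n ∧ y ∈ freeGr I n := by
  have aa : ∀ i j k l : I, fa i j * fa k l ∈ freeGr I (0, 2) := fun i j k l =>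
    mul_mem_freeGr (fa_mem i j) (fa_mem k l) rfl
  have ab : ∀ i j k l : I, fa i j * fb k l ∈ freeGr I (1, 2) := fun i j k l =>
    mul_mem_freeGr (fa_mem i j) (fb_mem k l) rfl
  have ba : ∀ i j k l : I, fb i j * fa k l ∈ freeGr I (1, 2) := fun i j k l =>
    mul_mem_freeGr (fb_mem i j) (fa_mem k l) rfl
  have bb : ∀ i j k l : I, fb i j * fb k l ∈ freeGr I (2, 2) := fun i j k l =>
    mul_mem_freeGr (fb_mem i j) (fb_mem k l) rfl
  cases h with
  | antisymm_a i j => exact ⟨_, fa_mem j i, Submodule.neg_mem _ (fa_mem i j)⟩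
  | antisymm_b i j => exact ⟨_, fb_mem j i, Submodule.neg_mem _ (fb_mem i j)⟩
  | comm_aa i j k l => exact ⟨_, aa _ _ _ _, aa _ _ _ _⟩
  | comm_ab i j k l => exact ⟨_, ab _ _ _ _, ba _ _ _ _⟩
  | comm_bb i j k l => exact ⟨_, bb _ _ _ _, Submodule.neg_mem _ (bb _ _ _ _)⟩
  | a_sq i j _ => exact ⟨_, aa _ _ _ _, Submodule.zero_mem _⟩
  | rel_aa i j k _ _ _ =>
    refine ⟨(0, 2), ?_, Submodule.zero_mem _⟩
    exact Submodule.add_mem _ (Submodule.add_mem _ (aa _ _ _ _) (aa _ _ _ _)) (aa _ _ _ _)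
  | rel_ab i j k _ _ _ =>
    refine ⟨(1, 2), ?_, Submodule.zero_mem _⟩
    repeat' apply Submodule.add_mem
    all_goals first | apply ab | apply ba
  | cycle_abb n _ c _ =>
    refine ⟨_, SetLike.GradedMul.mul_mem (fa_mem _ _)
      (SetLike.list_prod_ofFn_mem_graded (fun _ => (1, 1)) _ fun k => fb_mem _ _),
      Submodule.zero_mem _⟩
  | cycle_bbb n _ c _ =>
    exact ⟨_, SetLike.list_prod_ofFn_mem_graded (fun _ => (1, 1)) _ fun k => fb_mem _ _,
      Submodule.zero_mem _⟩
  | rel_bab i j k l _ =>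
    exact ⟨(2, 3), sum12_mem (fun i j k l => mul_mem_freeGr (ba i j j k) (fb_mem k l) rfl) _ _ _ _,
      Submodule.zero_mem _⟩
  | rel_bbb i j k l _ =>
    exact ⟨(3, 3), sum12_mem (fun i j k l => mul_mem_freeGr (bb i j j k) (fb_mem k l) rfl) _ _ _ _,
      Submodule.zero_mem _⟩

/-- The decomposition of `R I` into homogeneous components. -/
def decomposeHom (I : Type u) : Carrier I →ₐ[ℂ] ⨁ n, gr I n :=
  RingQuot.liftAlgHom ℂ ⟨preDecompose I, by
    intro x y h
    obtain ⟨n, hx, hy⟩ := h.homogeneous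
    rw [preDecompose_apply n x hx, preDecompose_apply n y hy]
    congr 1
    exact Subtype.ext (RingQuot.mkAlgHom_rel ℂ h)⟩

theorem decomposeHom_mk (x : FreeAlgebra ℂ (Gen I)) :
    decomposeHom I (mk I x) = preDecompose I x :=
  RingQuot.liftAlgHom_mkAlgHom_apply ℂ _ _ x

instance gradedAlgebra (I : Type u) : GradedAlgebra (gr I) :=
  GradedAlgebra.ofAlgHom (gr I) (decomposeHom I)
    (by
      apply RingQuot.ringQuot_ext'
      apply FreeAlgebra.hom_ext
      funext g
      change DirectSum.coeAlgHom (gr I) (decomposeHom I (mk I (FreeAlgebra.ι ℂ g))) =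
        mk I (FreeAlgebra.ι ℂ g)
      rw [decomposeHom_mk, preDecompose_apply _ _ (ι_mem g), DirectSum.coeAlgHom_of])
    (by
      rintro n ⟨_, x, hx, rfl⟩
      exact (decomposeHom_mk x).trans (preDecompose_apply n x hx))

end RAlg

/-- The bigraded algebra `R I`. -/
abbrev R (I : Type u) [Finite I] : BigradedAlg.{u} where
  carrier := RAlg.Carrier I
  gr := RAlg.gr I

namespace R

variable {I : Type u} [Finite I]

/-- The generator `a i j` of `R I`, of degree `(0, 1)`. -/
def a (i j : I) : R I := RAlg.mk I (RAlg.fa i j)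

/-- The generator `b i j` of `R I`, of degree `(1, 1)`. -/
def b (i j : I) : R I := RAlg.mk I (RAlg.fb i j)

end R

end

/-!
Write `s` for the Koszul sign of a bigraded algebra. All the structure maps are determined by their
values on the generators `a i j` and `b i j`, which gives uniqueness. For existence, every map is
obtained from the universal property of `R I`: `RAlg.Relations A B` states the defining relations
for families `A`, `B` of elements of an arbitrary algebra, and `RAlg.Relations.lift` is the
resulting algebra map. What has to be proved is that the prescribed values satisfy the relations.

* The basic fact about cycles is that a walk that visits a vertex twice gives the product zero in
  the elements `b`, so that a closed walk with at most one edge in `a` gives zero, whether or not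
  its vertices are distinct (`RAlg.Relations.closed_a`, `RAlg.Relations.closed_b`).
* A differential `d` corresponds to the algebra map that sends `x` to the upper triangular matrix
  with rows `(s x, d x)` and `(0, x)`. For `d a = b` the relations are immediate
  (`RAlg.Relations.tri_d`). For `d b = a` (`RAlg.Relations.tri_dPrime`) the cyclic relations reduce
  to the vanishing of closed walks with two edges in `a` (`RAlg.Relations.closed_aa`), and the
  relations with twelve terms to two linear identities (`RAlg.pathSum_aab_eq_zero`,
  `RAlg.pathSum_abb_eq_zero`).
* For the cocomposition, the generators with two indices in `J` go to the factor `R J`, and the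
  others to `R (I ⊔ {⋆})`, by the map that collapses `J` to `⋆`. A cycle in `I ⊔ J` that leaves `J`
  becomes a closed walk in `I ⊔ {⋆}` times further factors, and vanishes; the other relations are
  a case distinction (`RAlg.Relations.glued`).

The compatibilities with the differentials, naturality, coassociativity and the counit laws are
equalities of linear maps out of `R I`. By `R.linear_ext` it suffices that both sides agree on `1`
and turn left multiplication with a generator into the same operator. In a tensor product, these
operators multiply one factor and apply Koszul signs to the factors on its left
(`BigradedAlg.opL`, `BigradedAlg.opR` and their analogues for three factors).
-/

noncomputable section

namespace RAlg

/-! ### Walks and the defining relations in an arbitrary algebra -/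

section Walks

/-- The sum of `f` over the permutations of `i, j, k, l` up to reversal. -/
def pathSum {I M : Type*} [Add M] (f : I → I → I → I → M) (i j k l : I) : M :=
  f i j k l + f i k j l + f i j l k + f i l j k + f i k l j + f i l k j +
    f j i k l + f j k i l + f j i l k + f j l i k + f k i j l + f k j i l

variable {I T : Type*} [Ring T]

/-- The product of `B` over the consecutive edges of the walk that starts at `x` and then
visits the vertices of the list. -/
def walk (B : I → I → T) : I → List I → T
  | _, [] => 1
  | x, y :: l => B x y * walk B y l

/-- The last vertex of the walk that starts at `x` and then visits the vertices of the list. -/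
def walkEnd : I → List I → I
  | x, [] => x
  | _, y :: l => walkEnd y l

@[simp] theorem walk_nil (B : I → I → T) (x : I) : walk B x [] = 1 := rfl

@[simp] theorem walk_cons (B : I → I → T) (x y : I) (l : List I) :
    walk B x (y :: l) = B x y * walk B y l := rfl

@[simp] theorem walkEnd_nil (x : I) : walkEnd x [] = x := rfl

@[simp] theorem walkEnd_cons (x y : I) (l : List I) : walkEnd x (y :: l) = walkEnd y l := rfl

theorem walk_append (B : I → I → T) (x : I) (l m : List I) :
    walk B x (l ++ m) = walk B x l * walk B (walkEnd x l) m := by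
  induction l generalizing x with
  | nil => simp
  | cons y l ih => simp [ih, mul_assoc]

theorem walkEnd_append (x : I) (l m : List I) :
    walkEnd x (l ++ m) = walkEnd (walkEnd x l) m := by
  induction l generalizing x with
  | nil => rfl
  | cons y l ih => simp [ih]

theorem walkEnd_map {I' : Type*} (f : I → I') (x : I) (l : List I) :
    walkEnd (f x) (l.map f) = f (walkEnd x l) := by
  induction l generalizing x with
  | nil => rfl
  | cons y l ih => simp [ih]

theorem map_walk {T' F : Type*} [Ring T'] [FunLike F T T'] [RingHomClass F T T'] (f : F)
    (B : I → I → T) (x : I) (l : List I) :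
    f (walk B x l) = walk (fun i j => f (B i j)) x l := by
  induction l generalizing x with
  | nil => simp
  | cons y l ih => simp [ih]

theorem walk_comp {I' : Type*} (f : I' → I) (B : I → I → T) (x : I') (l : List I') :
    walk (fun i j => B (f i) (f j)) x l = walk B (f x) (l.map f) := by
  induction l generalizing x with
  | nil => rfl
  | cons y l ih => simp [ih]

theorem walk_neg (B : I → I → T) (x : I) (l : List I) :
    walk (fun i j => -B i j) x l = (-1) ^ l.length * walk B x l := by
  induction l generalizing x with
  | nil => simp
  | cons y l ih =>
    rw [walk_cons, ih, walk_cons, List.length_cons, pow_succ']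
    have h : Commute ((-1 : T) ^ l.length) (B x y) := (Commute.neg_one_left _).pow_left _
    simp only [neg_mul, one_mul, ← mul_assoc, h.eq]

/-- The products over the vertices of `Fin (m + 1)` are products over a walk. -/
theorem prod_ofFn_eq_walk (B : I → I → T) (m : ℕ) (e : Fin (m + 1) → I) :
    (List.ofFn fun k : Fin m => B (e k.castSucc) (e k.succ)).prod =
      walk B (e 0) (List.ofFn fun k : Fin m => e k.succ) := by
  induction m with
  | zero => simp
  | succ m ih =>
    rw [List.ofFn_succ, List.ofFn_succ, List.prod_cons, walk_cons]
    exact congrArg _ (ih fun k => e k.succ)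

theorem walkEnd_ofFn (m : ℕ) (e : Fin (m + 1) → I) :
    walkEnd (e 0) (List.ofFn fun k : Fin m => e k.succ) = e (Fin.last m) := by
  induction m with
  | zero => rfl
  | succ m ih =>
    rw [List.ofFn_succ, walkEnd_cons]
    exact ih fun k => e k.succ

/-- The cyclic products of the definition of `R I`, rotated by one step, are products over a
closed walk. -/
theorem cycle_eq_walk (A B : I → I → T) (m : ℕ) (c : Fin (m + 2) → I) :
    A (c 0) (c 1) * (List.ofFn fun k : Fin (m + 1) => B (c k.succ) (c (k.succ + 1))).prod =
      A (walkEnd (c 1) (List.ofFn fun k : Fin (m + 1) => c (k.succ + 1))) (c 1) *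
        walk B (c 1) (List.ofFn fun k : Fin (m + 1) => c (k.succ + 1)) := by
  have h1 := prod_ofFn_eq_walk B (m + 1) fun k => c (k + 1)
  have h2 := walkEnd_ofFn (m + 1) fun k => c (k + 1)
  simp only [Fin.coeSucc_eq_succ, zero_add, Fin.last_add_one] at h1 h2
  rw [h1, h2]

/-- The defining relations of `R I`, for families `A` and `B` of elements of an arbitrary
algebra in place of the generators `a` and `b`. The cyclic relations are written for the closed
walk that starts at `x`, follows `l`, and returns to `x`; its closing edge comes first. -/
structure Relations (A B : I → I → T) : Prop where
  antisymm_a : ∀ i j, A j i = -A i j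
  antisymm_b : ∀ i j, B j i = -B i j
  comm_aa : ∀ i j k l, A i j * A k l = A k l * A i j
  comm_ab : ∀ i j k l, A i j * B k l = B k l * A i j
  comm_bb : ∀ i j k l, B i j * B k l = -(B k l * B i j)
  a_sq : ∀ i j, i ≠ j → A i j * A i j = 0
  rel_aa : ∀ i j k, i ≠ j → j ≠ k → k ≠ i →
    A i j * A j k + A j k * A k i + A k i * A i j = 0
  rel_ab : ∀ i j k, i ≠ j → j ≠ k → k ≠ i →
    B i j * A j k + B j k * A k i + B k i * A i j +
      A i j * B j k + A j k * B k i + A k i * B i j = 0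
  cycle_a : ∀ x l, l ≠ [] → (x :: l).Nodup → A (walkEnd x l) x * walk B x l = 0
  cycle_b : ∀ x l, l ≠ [] → (x :: l).Nodup → B (walkEnd x l) x * walk B x l = 0
  rel_bab : ∀ i j k l, [i, j, k, l].Nodup →
    pathSum (fun i j k l => B i j * A j k * B k l) i j k l = 0
  rel_bbb : ∀ i j k l, [i, j, k, l].Nodup →
    pathSum (fun i j k l => B i j * B j k * B k l) i j k l = 0

theorem Relations.zero : Relations (fun _ _ : I => (0 : T)) (fun _ _ => 0) := by
  constructor <;> intros <;> simp [pathSum]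

theorem Relations.comp {I' : Type*} {A B : I → I → T} (h : Relations A B) (f : I' → I)
    (hf : Function.Injective f) :
    Relations (fun i j => A (f i) (f j)) (fun i j => B (f i) (f j)) where
  antisymm_a _ _ := h.antisymm_a _ _
  antisymm_b _ _ := h.antisymm_b _ _
  comm_aa _ _ _ _ := h.comm_aa _ _ _ _
  comm_ab _ _ _ _ := h.comm_ab _ _ _ _
  comm_bb _ _ _ _ := h.comm_bb _ _ _ _
  a_sq _ _ hij := h.a_sq _ _ (hf.ne hij)
  rel_aa _ _ _ h1 h2 h3 := h.rel_aa _ _ _ (hf.ne h1) (hf.ne h2) (hf.ne h3)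
  rel_ab _ _ _ h1 h2 h3 := h.rel_ab _ _ _ (hf.ne h1) (hf.ne h2) (hf.ne h3)
  cycle_a x l hl hx := by
    rw [walk_comp, ← walkEnd_map f]
    exact h.cycle_a _ _ (by simpa using hl) (by simpa using hx.map hf)
  cycle_b x l hl hx := by
    rw [walk_comp, ← walkEnd_map f]
    exact h.cycle_b _ _ (by simpa using hl) (by simpa using hx.map hf)
  rel_bab i j k l hn := h.rel_bab _ _ _ _ (by simpa using hn.map hf)
  rel_bbb i j k l hn := h.rel_bbb _ _ _ _ (by simpa using hn.map hf)

theorem Relations.map {T' F : Type*} [Ring T'] [FunLike F T T'] [RingHomClass F T T'] (f : F)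
    {A B : I → I → T} (h : Relations A B) :
    Relations (fun i j => f (A i j)) (fun i j => f (B i j)) where
  antisymm_a i j := by rw [h.antisymm_a, map_neg]
  antisymm_b i j := by rw [h.antisymm_b, map_neg]
  comm_aa i j k l := by rw [← map_mul, h.comm_aa, map_mul]
  comm_ab i j k l := by rw [← map_mul, h.comm_ab, map_mul]
  comm_bb i j k l := by rw [← map_mul, h.comm_bb, map_neg, map_mul]
  a_sq i j hij := by rw [← map_mul, h.a_sq i j hij, map_zero]
  rel_aa i j k h1 h2 h3 := by
    simpa only [map_add, map_mul, map_zero] using congrArg f (h.rel_aa i j k h1 h2 h3)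
  rel_ab i j k h1 h2 h3 := by
    simpa only [map_add, map_mul, map_zero] using congrArg f (h.rel_ab i j k h1 h2 h3)
  cycle_a x l hl hx := by rw [← map_walk, ← map_mul, h.cycle_a x l hl hx, map_zero]
  cycle_b x l hl hx := by rw [← map_walk, ← map_mul, h.cycle_b x l hl hx, map_zero]
  rel_bab i j k l hn := by
    simpa only [pathSum, map_add, map_mul, map_zero] using congrArg f (h.rel_bab i j k l hn)
  rel_bbb i j k l hn := by
    simpa only [pathSum, map_add, map_mul, map_zero] using congrArg f (h.rel_bbb i j k l hn)

/-- The relations are preserved by the change of sign of the odd generators. -/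
theorem Relations.neg_right {A B : I → I → T} (h : Relations A B) :
    Relations A (fun i j => -B i j) where
  antisymm_a := h.antisymm_a
  antisymm_b i j := by rw [h.antisymm_b]
  comm_aa := h.comm_aa
  comm_ab i j k l := by rw [mul_neg, h.comm_ab, neg_mul]
  comm_bb i j k l := by rw [neg_mul_neg, h.comm_bb, neg_mul_neg]
  a_sq := h.a_sq
  rel_aa := h.rel_aa
  rel_ab i j k h1 h2 h3 := by
    simpa only [neg_mul, mul_neg, ← neg_add, neg_eq_zero] using h.rel_ab i j k h1 h2 h3
  cycle_a x l hl hx := by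
    rw [walk_neg, ← mul_assoc, ← ((Commute.neg_one_left _).pow_left _).eq, mul_assoc,
      h.cycle_a x l hl hx, mul_zero]
  cycle_b x l hl hx := by
    rw [walk_neg, ← mul_assoc, ← ((Commute.neg_one_left _).pow_left _).eq, mul_assoc,
      neg_mul, h.cycle_b x l hl hx, neg_zero, mul_zero]
  rel_bab i j k l hn := by
    simpa only [neg_mul, mul_neg, neg_neg] using h.rel_bab i j k l hn
  rel_bbb i j k l hn := by
    simpa only [pathSum, neg_mul, mul_neg, neg_neg, ← neg_add, neg_eq_zero] using
      h.rel_bbb i j k l hn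

end Walks

/-! ### The universal property of `R I` -/

section Lift

variable {I : Type*} {T : Type*} [Ring T] [Algebra ℂ T]

/-- The relations hold for the generators of `R I`. -/
theorem relations_mk (I : Type*) :
    Relations (fun i j : I => mk I (fa i j)) (fun i j => mk I (fb i j)) := by
  have hr : ∀ {x y : FreeAlgebra ℂ (Gen I)}, Rel I x y → mk I x = mk I y :=
    fun h => RingQuot.mkAlgHom_rel ℂ h
  -- the cyclic sequence of indices of the walk `x :: l`, with the last vertex as `c 0`
  have key : ∀ (x : I) (l : List I), l ≠ [] → (x :: l).Nodup →
      ∃ (m : ℕ) (c : Fin (m + 2) → I), Function.Injective c ∧ c 1 = x ∧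
        (List.ofFn fun k : Fin (m + 1) => c (k.succ + 1)) = l := by
    intro x l hl hx
    obtain ⟨y, l, rfl⟩ := List.exists_cons_of_ne_nil hl
    refine ⟨l.length, fun k => (x :: y :: l).get (k - 1), ?_, ?_, ?_⟩
    · intro i j hij
      have := (List.nodup_iff_injective_get.mp hx) hij
      simpa using this
    · simp
    · simp only [add_sub_cancel_right]
      exact List.ofFn_get (y :: l)
  constructor
  · exact fun i j => (hr (Rel.antisymm_a i j)).trans (map_neg _ _)
  · exact fun i j => (hr (Rel.antisymm_b i j)).trans (map_neg _ _)
  · intro i j k l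
    simpa only [map_mul] using hr (Rel.comm_aa i j k l)
  · intro i j k l
    simpa only [map_mul] using hr (Rel.comm_ab i j k l)
  · intro i j k l
    simpa only [map_mul, map_neg] using hr (Rel.comm_bb i j k l)
  · intro i j hij
    simpa only [map_mul, map_zero] using hr (Rel.a_sq i j hij)
  · intro i j k h1 h2 h3
    simpa only [map_mul, map_add, map_zero] using hr (Rel.rel_aa i j k h1 h2 h3)
  · intro i j k h1 h2 h3
    simpa only [map_mul, map_add, map_zero] using hr (Rel.rel_ab i j k h1 h2 h3)
  · intro x l hl hx
    obtain ⟨m, c, hc, rfl, rfl⟩ := key x l hl hx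
    have h := hr (Rel.cycle_abb (m + 1) (Nat.le_add_left 1 m) c hc)
    rw [cycle_eq_walk, map_mul, map_walk, map_zero] at h
    exact h
  · intro x l hl hx
    obtain ⟨m, c, hc, rfl, rfl⟩ := key x l hl hx
    have h := hr (Rel.cycle_bbb (m + 1) (Nat.le_add_left 1 m) c hc)
    rw [List.ofFn_succ, List.prod_cons, zero_add, cycle_eq_walk, map_mul, map_walk, map_zero] at h
    exact h
  · intro i j k l hn
    simpa only [sum12, bab, pathSum, map_mul, map_add, map_zero] using hr (Rel.rel_bab i j k l hn)
  · intro i j k l hn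
    simpa only [sum12, bbb, pathSum, map_mul, map_add, map_zero] using hr (Rel.rel_bbb i j k l hn)

/-- The algebra map out of the free algebra with prescribed images of the generators. -/
def freeLift (A B : I → I → T) : FreeAlgebra ℂ (Gen I) →ₐ[ℂ] T :=
  FreeAlgebra.lift ℂ fun g => match g with
    | Gen.a i j => A i j
    | Gen.b i j => B i j

@[simp] theorem freeLift_fa (A B : I → I → T) (i j : I) : freeLift A B (fa i j) = A i j :=
  FreeAlgebra.lift_ι_apply _ _

@[simp] theorem freeLift_fb (A B : I → I → T) (i j : I) : freeLift A B (fb i j) = B i j :=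
  FreeAlgebra.lift_ι_apply _ _

theorem Relations.freeLift_eq {A B : I → I → T} (h : Relations A B)
    {x y : FreeAlgebra ℂ (Gen I)} (r : Rel I x y) : freeLift A B x = freeLift A B y := by
  have key : ∀ (m : ℕ) (c : Fin (m + 2) → I), Function.Injective c →
      (c 1 :: List.ofFn fun k : Fin (m + 1) => c (k.succ + 1)).Nodup := by
    intro m c hc
    have : (c 1 :: List.ofFn fun k : Fin (m + 1) => c (k.succ + 1)) =
        List.ofFn fun k : Fin (m + 2) => c (k + 1) := by
      rw [List.ofFn_succ (n := m + 1), zero_add]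
    rw [this, List.nodup_ofFn]
    exact hc.comp (add_left_injective 1)
  cases r with
  | antisymm_a i j => simpa using h.antisymm_a i j
  | antisymm_b i j => simpa using h.antisymm_b i j
  | comm_aa i j k l => simpa using h.comm_aa i j k l
  | comm_ab i j k l => simpa using h.comm_ab i j k l
  | comm_bb i j k l => simpa using h.comm_bb i j k l
  | a_sq i j hij => simpa using h.a_sq i j hij
  | rel_aa i j k h1 h2 h3 => simpa using h.rel_aa i j k h1 h2 h3
  | rel_ab i j k h1 h2 h3 => simpa using h.rel_ab i j k h1 h2 h3
  | cycle_abb n hn c hc =>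
    obtain ⟨m, rfl⟩ := Nat.exists_eq_add_of_le' hn
    rw [cycle_eq_walk, map_mul, map_walk, map_zero]
    simpa using h.cycle_a _ _ (by simp [List.ofFn_succ]) (key m c hc)
  | cycle_bbb n hn c hc =>
    obtain ⟨m, rfl⟩ := Nat.exists_eq_add_of_le' hn
    rw [List.ofFn_succ, List.prod_cons, zero_add, cycle_eq_walk, map_mul, map_walk, map_zero]
    simpa using h.cycle_b _ _ (by simp [List.ofFn_succ]) (key m c hc)
  | rel_bab i j k l hn => simpa [sum12, bab, pathSum] using h.rel_bab i j k l hn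
  | rel_bbb i j k l hn => simpa [sum12, bbb, pathSum] using h.rel_bbb i j k l hn

/-- The algebra map out of `R I` given by elements that satisfy the defining relations. -/
def Relations.lift {A B : I → I → T} (h : Relations A B) : Carrier I →ₐ[ℂ] T :=
  RingQuot.liftAlgHom ℂ ⟨freeLift A B, fun _ _ r => h.freeLift_eq r⟩

theorem Relations.lift_mk {A B : I → I → T} (h : Relations A B) (x : FreeAlgebra ℂ (Gen I)) :
    h.lift (RAlg.mk I x) = freeLift A B x :=
  RingQuot.liftAlgHom_mkAlgHom_apply ℂ _ _ x

end Lift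

/-! ### Closed walks -/

/-- The elements `x` and `y` commute up to a sign. -/
def SignCommute {T : Type*} [Ring T] (x y : T) : Prop := x * y = y * x ∨ x * y = -(y * x)

namespace SignCommute

variable {T : Type*} [Ring T] {x y z : T}

theorem one_right (x : T) : SignCommute x 1 := Or.inl (by simp)

theorem symm (h : SignCommute x y) : SignCommute y x := by
  rcases h with h | h
  · exact Or.inl h.symm
  · exact Or.inr (by rw [h, neg_neg])

theorem mul_right (hy : SignCommute x y) (hz : SignCommute x z) : SignCommute x (y * z) := by
  rcases hy with hy | hy <;> rcases hz with hz | hz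
  · exact Or.inl (by rw [← mul_assoc, hy, mul_assoc, hz, mul_assoc])
  · exact Or.inr (by rw [← mul_assoc, hy, mul_assoc, hz, mul_neg, mul_assoc])
  · exact Or.inr (by rw [← mul_assoc, hy, neg_mul, mul_assoc, hz, mul_assoc])
  · exact Or.inl (by rw [← mul_assoc, hy, neg_mul, mul_assoc, hz, mul_neg, neg_neg, mul_assoc])

theorem mul_eq_zero_comm (h : SignCommute x y) (h0 : x * y = 0) : y * x = 0 := by
  rcases h with h | h
  · rw [← h, h0]
  · rw [← neg_eq_zero, ← h, h0]

theorem walk_right {I : Type*} {B : I → I → T} (h : ∀ i j, SignCommute x (B i j)) (i : I)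
    (l : List I) : SignCommute x (walk B i l) := by
  induction l generalizing i with
  | nil => exact one_right x
  | cons j l ih => exact (h i j).mul_right (ih j)

end SignCommute

namespace Relations

variable {I T : Type*} [Ring T] {A B : I → I → T}

theorem commute_a_walk (h : Relations A B) (i j x : I) (l : List I) :
    A i j * walk B x l = walk B x l * A i j := by
  induction l generalizing x with
  | nil => simp
  | cons y l ih => rw [walk_cons, ← mul_assoc, h.comm_ab, mul_assoc, ih, mul_assoc]

theorem signCommute_b_walk (h : Relations A B) (i j x : I) (l : List I) :
    SignCommute (B i j) (walk B x l) :=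
  SignCommute.walk_right (fun _ _ => Or.inr (h.comm_bb _ _ _ _)) x l

theorem signCommute_walk_walk (h : Relations A B) (y : I) (m : List I) (x : I) (l : List I) :
    SignCommute (walk B y m) (walk B x l) :=
  SignCommute.walk_right (fun i j => (h.signCommute_b_walk i j y m).symm) x l

variable [Algebra ℂ T]

theorem a_self (h : Relations A B) (i : I) : A i i = 0 := by
  have h1 : (2 : ℂ) • A i i = 0 := by
    rw [two_smul]; nth_rewrite 1 [h.antisymm_a i i]; exact neg_add_cancel _
  simpa using h1

theorem b_self (h : Relations A B) (i : I) : B i i = 0 := by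
  have h1 : (2 : ℂ) • B i i = 0 := by
    rw [two_smul]; nth_rewrite 1 [h.antisymm_b i i]; exact neg_add_cancel _
  simpa using h1

theorem a_sq' (h : Relations A B) (i j : I) : A i j * A i j = 0 := by
  by_cases hij : i = j
  · subst hij; rw [h.a_self, zero_mul]
  · exact h.a_sq i j hij

theorem a_mul_b (h : Relations A B) (i j : I) : A i j * B i j = 0 := by
  by_cases hij : i = j
  · subst hij; rw [h.a_self, zero_mul]
  · have h1 := h.cycle_a j [i] (by simp) (by simp [Ne.symm hij])
    rw [walkEnd_cons, walkEnd_nil, walk_cons, walk_nil, mul_one, h.antisymm_b, mul_neg,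
      neg_eq_zero] at h1
    exact h1

theorem b_mul_a (h : Relations A B) (i j : I) : B i j * A i j = 0 := by
  rw [← h.comm_ab, h.a_mul_b]

/-- The three-term relation holds for coinciding indices as well. -/
theorem rel_aa' (h : Relations A B) (i j k : I) :
    A i j * A j k + A j k * A k i + A k i * A i j = 0 := by
  by_cases h1 : i = j
  · subst h1
    rw [h.a_self, h.antisymm_a k i, zero_mul, mul_zero, neg_mul, h.a_sq']; simp
  by_cases h2 : j = k
  · subst h2
    rw [h.a_self, h.antisymm_a i j, zero_mul, mul_zero, neg_mul, h.a_sq']; simp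
  by_cases h3 : k = i
  · subst h3
    rw [h.a_self, h.antisymm_a k j, zero_mul, mul_zero, mul_neg, h.a_sq']; simp
  exact h.rel_aa i j k h1 h2 h3

/-- The six-term relation holds for coinciding indices as well. -/
theorem rel_ab' (h : Relations A B) (i j k : I) :
    B i j * A j k + B j k * A k i + B k i * A i j +
      A i j * B j k + A j k * B k i + A k i * B i j = 0 := by
  by_cases h1 : i = j
  · subst h1
    rw [h.a_self, h.b_self, h.antisymm_a k i, h.antisymm_b k i]
    simp [h.a_mul_b, h.b_mul_a]
  by_cases h2 : j = k
  · subst h2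
    rw [h.a_self, h.b_self, h.antisymm_a i j, h.antisymm_b i j]
    simp [h.a_mul_b, h.b_mul_a]
  by_cases h3 : k = i
  · subst h3
    rw [h.a_self, h.b_self, h.antisymm_a k j, h.antisymm_b k j]
    simp [h.a_mul_b, h.b_mul_a]
  exact h.rel_ab i j k h1 h2 h3

/-- A walk that visits a vertex twice gives the product zero, since it contains a cycle. -/
theorem walk_eq_zero (h : Relations A B) (x : I) (l : List I) (hx : ¬ (x :: l).Nodup) :
    walk B x l = 0 := by
  induction l generalizing x with
  | nil => simp at hx
  | cons y l ih =>
    by_cases hy : (y :: l).Nodup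
    · have hmem : x ∈ y :: l := by
        by_contra hxy
        exact hx (List.nodup_cons.mpr ⟨hxy, hy⟩)
      obtain ⟨q, r, hqr⟩ := List.append_of_mem hmem
      have hsplit : walk B x (y :: l) = walk B x (q ++ [x]) * walk B x r := by
        rw [hqr, ← List.singleton_append, ← List.append_assoc, walk_append, walkEnd_append]
        rfl
      have hcycle : walk B x (q ++ [x]) = 0 := by
        cases q with
        | nil => simp [h.b_self]
        | cons z q =>
          have hn : (z :: (q ++ [x])).Nodup := by
            refine List.Nodup.sublist ?_ hy
            rw [hqr, ← List.singleton_append (l := r), ← List.append_assoc]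
            exact List.sublist_append_left _ _
          simpa [walkEnd_append] using h.cycle_b z (q ++ [x]) (by simp) hn
      rw [hsplit, hcycle, zero_mul]
    · rw [walk_cons, ih y hy, mul_zero]

/-- Closed walks with one edge in `A` give the product zero, even if vertices are repeated. -/
theorem closed_a (h : Relations A B) (x : I) (l : List I) :
    A (walkEnd x l) x * walk B x l = 0 := by
  by_cases hl : l = []
  · simp [hl, h.a_self]
  · by_cases hx : (x :: l).Nodup
    · exact h.cycle_a x l hl hx
    · rw [h.walk_eq_zero x l hx, mul_zero]

theorem closed_b (h : Relations A B) (x : I) (l : List I) :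
    B (walkEnd x l) x * walk B x l = 0 := by
  by_cases hl : l = []
  · simp [hl, h.b_self]
  · by_cases hx : (x :: l).Nodup
    · exact h.cycle_b x l hl hx
    · rw [h.walk_eq_zero x l hx, mul_zero]

/-- Closed walks with the edge in `A` at an arbitrary place give the product zero. -/
theorem closed_a_middle (h : Relations A B) (x : I) (l : List I) (v : I) (m : List I)
    (hv : walkEnd v m = x) : walk B x l * (A (walkEnd x l) v * walk B v m) = 0 := by
  have h1 := h.closed_a v (m ++ l)
  rw [walkEnd_append, hv, walk_append, hv, ← mul_assoc] at h1
  refine SignCommute.mul_eq_zero_comm (SignCommute.symm ?_) h1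
  exact SignCommute.mul_right (Or.inl (h.commute_a_walk _ _ _ _).symm)
    (h.signCommute_walk_walk _ _ _ _)

/-- Closed walks with two edges in `A` give the product zero. The three-term relation disposes
of adjacent edges in `A`, and the six-term relation moves the two edges towards each other. -/
theorem closed_aa (h : Relations A B) (l : List I) :
    ∀ (x v : I) (m : List I),
      A (walkEnd v m) x * (walk B x l * (A (walkEnd x l) v * walk B v m)) = 0 := by
  induction l with
  | nil =>
    intro x v m
    have h1 := h.rel_aa' (walkEnd v m) x v
    rw [walk_nil, walkEnd_nil, one_mul, ← mul_assoc]
    set u := walkEnd v m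
    have h3 : A u x * A x v = -(A x v * A v u + A u x * A v u) := by
      rw [h.comm_aa u x v u, eq_neg_iff_add_eq_zero, ← add_assoc]
      exact h1
    have h4 : A v u * walk B v m = 0 := by
      rw [h.antisymm_a u v, ← neg_eq_zero, ← neg_mul, neg_neg]; exact h.closed_a v m
    rw [h3, neg_mul, add_mul, mul_assoc, mul_assoc, h4, mul_zero, mul_zero, add_zero, neg_zero]
  | cons y l ih =>
    intro x v m
    rw [walkEnd_cons, walk_cons]
    set u := walkEnd v m with hu
    set W := walk B y l * (A (walkEnd y l) v * walk B v m) with hW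
    have h1 := h.rel_ab' u x y
    -- the edge `u y` closes the part of the walk from `y` to `u`
    have hb : B y u * W = 0 := by
      have := h.closed_a_middle u (y :: l) v m rfl
      rw [walk_cons, walkEnd_cons, mul_assoc] at this
      rw [h.antisymm_b u y, neg_mul, this, neg_zero]
    have ha : A y u * W = 0 := by
      rw [h.antisymm_a u y, neg_mul, ih y v m, neg_zero]
    -- the walk that starts with the edge `x y` and returns through the edge `u x`
    have hc : A x y * (B u x * W) = 0 := by
      have h2 := ih y v (m ++ [x])
      rw [walkEnd_append, walk_append, ← hu] at h2
      have h3 : W * B u x = walk B y l * (A (walkEnd y l) v * (walk B v m * walk B u [x])) := by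
        simp [hW, mul_assoc]
      simp only [walkEnd_cons, walkEnd_nil] at h2
      rw [← h3] at h2
      have h4 : SignCommute (B u x) W :=
        (h.signCommute_b_walk _ _ _ _).mul_right
          (SignCommute.mul_right (Or.inl (h.comm_ab _ _ _ _).symm) (h.signCommute_b_walk _ _ _ _))
      rcases h4 with h4 | h4
      · rw [h4, h2]
      · rw [h4, mul_neg, h2, neg_zero]
    have h5 : A u x * (B x y * W) =
        (B u x * A x y + B x y * A y u + B y u * A u x +
          A u x * B x y + A x y * B y u + A y u * B u x) * W -
        (A x y * (B u x * W) + B x y * (A y u * W) + A u x * (B y u * W) + A x y * (B y u * W) +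
          B u x * (A y u * W)) := by
      rw [← h.comm_ab x y u x, ← h.comm_ab u x y u, h.comm_ab y u u x]
      noncomm_ring
    rw [mul_assoc, h5, h1, ha, hb, hc]
    simp

end Relations

/-! ### The four-index relations under the second differential -/

section FourIndices

variable {I S M : Type*} [CommRing S] [AddCommGroup M] [Module S M]

/-- The sum over all paths `a a b` vanishes. Modulo the six-term relation, multiplied by one
edge, it is the sum over the stars `a a b`, which is twice the sum that the three-term relation
identifies with the opposite of the sum over the paths. -/
theorem pathSum_aab_eq_zero (h3 : ∀ x : M, (3 : S) • x = 0 → x = 0) (a : I → I → S)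
    (β : I → I → M) (ha : ∀ i j, a j i = -a i j) (hβ : ∀ i j, β j i = -β i j)
    (haa : ∀ i j k, a i j * a j k + a j k * a k i + a k i * a i j = 0)
    (hab : ∀ i j k, a j k • β i j + a k i • β j k + a i j • β k i +
      a i j • β j k + a j k • β k i + a k i • β i j = 0) (i j k l : I) :
    pathSum (fun i j k l => (a i j * a j k) • β k l - (a j k * a k l) • β i j) i j k l = 0 := by
  apply h3
  have e1 := hab j k l
  have e2 := hab i k l
  have e3 := hab i j l
  have e4 := hab i j k
  have f1 := haa j k l
  have f2 := haa i k l
  have f3 := haa i j l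
  have f4 := haa i j k
  simp only [pathSum, ha i j, ha i k, ha i l, ha j k, ha j l, ha k l, hβ i j, hβ i k, hβ i l,
    hβ j k, hβ j l, hβ k l] at e1 e2 e3 e4 f1 f2 f3 f4 ⊢
  linear_combination (norm := module) (a i j + a i k + a i l) • e1 +
    (-a i j + a j k + a j l) • e2 + (-a i k - a j k + a k l) • e3 +
    (-a i l - a j l - a k l) • e4 +
    (2 : S) • (f1 • (-β i j - β i k - β i l) + f2 • (β i j - β j k - β j l) +
      f3 • (β i k + β j k - β k l) + f4 • (β i l + β j l + β k l))

/-- The relation for the paths `b a b` implies that the signed sum over the paths with one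
edge `a` vanishes, by the six-term relation multiplied by one edge `b`. Here `γ i j k l` stands
for `b i j * b k l`. -/
theorem pathSum_abb_eq_zero (a : I → I → S) (γ : I → I → I → I → M)
    (ha : ∀ i j, a j i = -a i j) (hγ₁ : ∀ i j k l, γ j i k l = -γ i j k l)
    (hγ₂ : ∀ i j k l, γ i j l k = -γ i j k l) (hγ : ∀ i j k l, γ k l i j = -γ i j k l)
    (hab : ∀ p q i j k, a j k • γ p q i j + a k i • γ p q j k + a i j • γ p q k i +
      a i j • γ p q j k + a j k • γ p q k i + a k i • γ p q i j = 0) (i j k l : I)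
    (h : pathSum (fun i j k l => a j k • γ i j k l) i j k l = 0) :
    pathSum (fun i j k l => a i j • γ j k k l - a j k • γ i j k l + a k l • γ i j j k) i j k l
      = 0 := by
  have e1 := fun p q => hab p q j k l
  have e2 := fun p q => hab p q i k l
  have e3 := fun p q => hab p q i j l
  have e4 := fun p q => hab p q i j k
  have e11 := e1 i j
  have e12 := e1 i k
  have e13 := e1 i l
  have e21 := e2 i j
  have e22 := e2 j k
  have e23 := e2 j l
  have e31 := e3 i k
  have e32 := e3 j k
  have e33 := e3 k l
  have e41 := e4 i l
  have e42 := e4 j l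
  have e43 := e4 k l
  clear e1 e2 e3 e4
  simp only [pathSum, ha i j, ha i k, ha i l, ha j k, ha j l, ha k l, hγ₁ i j, hγ₁ i k, hγ₁ i l,
    hγ₁ j k, hγ₁ j l, hγ₁ k l, hγ₂ _ _ i j, hγ₂ _ _ i k, hγ₂ _ _ i l,
    hγ₂ _ _ j k, hγ₂ _ _ j l, hγ₂ _ _ k l, hγ i j i k, hγ i j i l, hγ i j j k, hγ i j j l,
    hγ i j k l, hγ i k i l, hγ i k j k, hγ i k j l, hγ i k k l, hγ i l j k, hγ i l j l,
    hγ i l k l, hγ j k j l, hγ j k k l, hγ j l k l]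
    at h e11 e12 e13 e21 e22 e23 e31 e32 e33 e41 e42 e43 ⊢
  linear_combination (norm := module) (e11 + e12 + e13 - e21 + e22 + e23 - e31 - e32 + e33 - e41
    - e42 - e43) - (3:S) • h

end FourIndices

/-! ### Derivations as upper triangular matrices -/

/-- The upper triangular matrix with diagonal `p, r` and with `q` above the diagonal. A map `d`
satisfies `d (x * y) = d x * y + s x * d y` for an algebra map `s` if and only if
`x ↦ tri (s x) (d x) x` is multiplicative. -/
def tri {T : Type*} [Ring T] (p q r : T) : Matrix (Fin 2) (Fin 2) T := !![p, q; 0, r]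

section Tri

variable {T : Type*} [Ring T]

theorem tri_mul (p q r p' q' r' : T) :
    tri p q r * tri p' q' r' = tri (p * p') (p * q' + q * r') (r * r') := by
  simp [tri]

theorem tri_add (p q r p' q' r' : T) :
    tri p q r + tri p' q' r' = tri (p + p') (q + q') (r + r') := by
  simp [tri]

theorem tri_neg (p q r : T) : -tri p q r = tri (-p) (-q) (-r) := by
  simp [tri]

theorem tri_smul [Algebra ℂ T] (c : ℂ) (p q r : T) :
    c • tri p q r = tri (c • p) (c • q) (c • r) := by
  simp [tri]

theorem tri_one : tri (1 : T) 0 1 = 1 := by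
  simp [tri, Matrix.one_fin_two]

theorem tri_zero : tri (0 : T) 0 0 = 0 := by
  ext i j; fin_cases i <;> fin_cases j <;> rfl

theorem tri_congr {p q r p' q' r' : T} (hp : p = p') (hq : q = q') (hr : r = r') :
    tri p q r = tri p' q' r' := by rw [hp, hq, hr]

theorem tri_eq_zero {p q r : T} (hp : p = 0) (hq : q = 0) (hr : r = 0) : tri p q r = 0 := by
  rw [hp, hq, hr, tri_zero]

theorem pathSum_tri {I : Type*} (f g h : I → I → I → I → T) (i j k l : I) :
    pathSum (fun i j k l => tri (f i j k l) (g i j k l) (h i j k l)) i j k l =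
      tri (pathSum f i j k l) (pathSum g i j k l) (pathSum h i j k l) := by
  simp only [pathSum, tri_add]

/-- The signed sum of the products that are obtained from `walk B x l` by the replacement of one
factor of `B` by the corresponding factor of `A`. -/
def dwalk {I : Type*} (A B : I → I → T) : I → List I → T
  | _, [] => 0
  | x, y :: l => -B x y * dwalk A B y l + A x y * walk B y l

theorem walk_tri {I : Type*} (A B : I → I → T) (x : I) (l : List I) :
    walk (fun i j => tri (-B i j) (A i j) (B i j)) x l =
      tri (walk (fun i j => -B i j) x l) (dwalk A B x l) (walk B x l) := by
  induction l generalizing x with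
  | nil => simp [dwalk, tri_one]
  | cons y l ih => simp only [walk_cons, ih, tri_mul, dwalk]

theorem walk_tri_zero {I : Type*} (B : I → I → T) (x : I) (l : List I) :
    walk (fun i j => tri (-B i j) 0 (B i j)) x l =
      tri (walk (fun i j => -B i j) x l) 0 (walk B x l) := by
  induction l generalizing x with
  | nil => simp [tri_one]
  | cons y l ih => simp only [walk_cons, ih, tri_mul, mul_zero, zero_mul, add_zero]

/-- The product of `C`, a walk, and the signed sum `dwalk` for the rest of the walk vanishes if it
vanishes separately for each place at which a factor of `B` is replaced by one of `A`. -/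
theorem mul_walk_mul_dwalk {I : Type*} {A B : I → I → T} {C : T} {x e : I}
    (hC : ∀ l v m, walkEnd v m = e →
      C * (walk B x l * (A (walkEnd x l) v * walk B v m)) = 0)
    (m : List I) : ∀ l, walkEnd (walkEnd x l) m = e →
      C * (walk B x l * dwalk A B (walkEnd x l) m) = 0 := by
  induction m with
  | nil => intro l _; simp [dwalk]
  | cons v m ih =>
    intro l hl
    rw [walkEnd_cons] at hl
    have h1 := ih (l ++ [v]) (by rwa [walkEnd_append])
    rw [walk_append, walkEnd_append, walkEnd_cons, walkEnd_nil, walk_cons, walk_nil, mul_one,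
      mul_assoc] at h1
    rw [dwalk, mul_add, mul_add, hC l v m hl, neg_mul, mul_neg, mul_neg, h1, neg_zero, add_zero]

end Tri

section Differentials

variable {I T : Type*} [Ring T] [Algebra ℂ T] {A B : I → I → T}

/-- The differential that sends `a i j` to `b i j` respects the relations. -/
theorem Relations.tri_d (h : Relations A B) :
    Relations (fun i j => tri (A i j) (B i j) (A i j))
      (fun i j => tri (-B i j) 0 (B i j)) := by
  have h' := h.neg_right
  constructor
  · intro i j
    rw [tri_neg, h.antisymm_a, h.antisymm_b]
  · intro i j
    rw [tri_neg, h.antisymm_b, neg_zero]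
  · intro i j k l
    simp only [tri_mul]
    refine tri_congr (h.comm_aa _ _ _ _) ?_ (h.comm_aa _ _ _ _)
    rw [h.comm_ab, ← h.comm_ab k l i j, add_comm]
  · intro i j k l
    simp only [tri_mul]
    refine tri_congr (h'.comm_ab _ _ _ _) ?_ (h.comm_ab _ _ _ _)
    rw [h.comm_bb, mul_zero, zero_mul, zero_add, add_zero, neg_mul]
  · intro i j k l
    simp only [tri_mul, tri_neg]
    refine tri_congr (h'.comm_bb _ _ _ _) ?_ (h.comm_bb _ _ _ _)
    simp
  · intro i j hij
    rw [tri_mul]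
    refine tri_eq_zero (h.a_sq _ _ hij) ?_ (h.a_sq _ _ hij)
    rw [h.a_mul_b, h.b_mul_a, add_zero]
  · intro i j k h1 h2 h3
    simp only [tri_mul, tri_add]
    refine tri_eq_zero (h.rel_aa _ _ _ h1 h2 h3) ?_ (h.rel_aa _ _ _ h1 h2 h3)
    rw [← h.rel_ab i j k h1 h2 h3]
    abel
  · intro i j k h1 h2 h3
    simp only [tri_mul, tri_add]
    refine tri_eq_zero (h'.rel_ab _ _ _ h1 h2 h3) ?_ (h.rel_ab _ _ _ h1 h2 h3)
    noncomm_ring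
  · intro x l hl hx
    rw [walk_tri_zero, tri_mul]
    refine tri_eq_zero (h'.cycle_a x l hl hx) ?_ (h.cycle_a x l hl hx)
    rw [mul_zero, zero_add, h.cycle_b x l hl hx]
  · intro x l hl hx
    rw [walk_tri_zero, tri_mul]
    refine tri_eq_zero (h'.cycle_b x l hl hx) ?_ (h.cycle_b x l hl hx)
    rw [mul_zero, zero_add, zero_mul]
  · intro i j k l hn
    simp only [tri_mul, pathSum_tri]
    refine tri_eq_zero (h'.rel_bab i j k l hn) ?_ (h.rel_bab i j k l hn)
    simpa only [pathSum, mul_zero, zero_mul, zero_add, add_zero, neg_mul, ← neg_add, neg_eq_zero]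
      using h.rel_bbb i j k l hn
  · intro i j k l hn
    simp only [tri_mul, pathSum_tri]
    refine tri_eq_zero (h'.rel_bbb i j k l hn) ?_ (h.rel_bbb i j k l hn)
    simp [pathSum]

/-- The differential that sends `b i j` to `a i j` respects the relations. -/
theorem Relations.tri_dPrime (h : Relations A B) (hA : ∀ i j x, A i j * x = x * A i j) :
    Relations (fun i j => tri (A i j) 0 (A i j))
      (fun i j => tri (-B i j) (A i j) (B i j)) := by
  have h' := h.neg_right
  -- the elements of `A` as scalars, to make the four-index relations linear
  let z : I → I → Subalgebra.center ℂ T := fun i j =>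
    ⟨A i j, Subalgebra.mem_center_iff.mpr fun x => (hA i j x).symm⟩
  have hz : ∀ i j (x : T), z i j • x = A i j * x := fun _ _ _ => rfl
  have hz1 : ∀ i j, z j i = -z i j := fun i j => Subtype.ext (h.antisymm_a i j)
  constructor
  · intro i j
    rw [tri_neg, h.antisymm_a, neg_zero]
  · intro i j
    rw [tri_neg, h.antisymm_b, h.antisymm_a]
  · intro i j k l
    simp only [tri_mul]
    refine tri_congr (h.comm_aa _ _ _ _) ?_ (h.comm_aa _ _ _ _)
    simp
  · intro i j k l
    simp only [tri_mul]
    refine tri_congr (h'.comm_ab _ _ _ _) ?_ (h.comm_ab _ _ _ _)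
    rw [h.comm_aa, mul_zero, zero_mul, zero_add, add_zero]
  · intro i j k l
    simp only [tri_mul, tri_neg]
    refine tri_congr (h'.comm_bb _ _ _ _) ?_ (h.comm_bb _ _ _ _)
    rw [h.comm_ab i j k l, h.comm_ab k l i j]
    noncomm_ring
  · intro i j hij
    rw [tri_mul]
    refine tri_eq_zero (h.a_sq _ _ hij) ?_ (h.a_sq _ _ hij)
    simp
  · intro i j k h1 h2 h3
    simp only [tri_mul, tri_add]
    refine tri_eq_zero (h.rel_aa _ _ _ h1 h2 h3) ?_ (h.rel_aa _ _ _ h1 h2 h3)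
    simp
  · intro i j k h1 h2 h3
    simp only [tri_mul, tri_add]
    refine tri_eq_zero (h'.rel_ab _ _ _ h1 h2 h3) ?_ (h.rel_ab _ _ _ h1 h2 h3)
    have h4 := h.rel_aa i j k h1 h2 h3
    simp only [mul_zero, zero_mul, zero_add, add_zero]
    calc _ = (A i j * A j k + A j k * A k i + A k i * A i j) +
          (A i j * A j k + A j k * A k i + A k i * A i j) := by abel
      _ = 0 := by rw [h4, add_zero]
  · intro x l hl hx
    rw [walk_tri, tri_mul]
    refine tri_eq_zero (h'.cycle_a x l hl hx) ?_ (h.cycle_a x l hl hx)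
    rw [zero_mul, add_zero]
    have := mul_walk_mul_dwalk (A := A) (B := B) (C := A (walkEnd x l) x) (x := x)
      (e := walkEnd x l) (fun p v m hm => by rw [← hm]; exact h.closed_aa p x v m) l [] rfl
    simpa using this
  · intro x l hl hx
    rw [walk_tri, tri_mul]
    refine tri_eq_zero (h'.cycle_b x l hl hx) ?_ (h.cycle_b x l hl hx)
    rw [h.closed_a, add_zero, neg_mul, neg_eq_zero]
    have := mul_walk_mul_dwalk (A := A) (B := B) (C := B (walkEnd x l) x) (x := x)
      (e := walkEnd x l) (fun p v m hm => by
        have := h.closed_a_middle (walkEnd x l) (x :: p) v m hm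
        rwa [walk_cons, walkEnd_cons, mul_assoc] at this) l [] rfl
    simpa using this
  · intro i j k l hn
    simp only [tri_mul, pathSum_tri]
    refine tri_eq_zero (h'.rel_bab i j k l hn) ?_ (h.rel_bab i j k l hn)
    have h3 : ∀ x : T, (3 : Subalgebra.center ℂ T) • x = 0 → x = 0 := by
      intro x hx
      have : (3 : ℂ) • x = 0 := by
        rw [← hx, Algebra.smul_def, map_ofNat]
        rfl
      simpa using this
    have key := pathSum_aab_eq_zero h3 z B hz1 h.antisymm_b
      (fun i j k => Subtype.ext (h.rel_aa' i j k))
      (fun i j k => by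
        simp only [hz, hA]
        have := h.rel_ab' i j k
        simpa only [h.comm_ab] using this) i j k l
    refine Eq.trans ?_ key
    simp only [mul_smul, hz]
    congr 1
    funext i j k l
    have e : B i j * A j k * A k l = A j k * (A k l * B i j) := by
      rw [← h.comm_ab, mul_assoc, ← hA k l]
    rw [← e]
    noncomm_ring
  · intro i j k l hn
    simp only [tri_mul, pathSum_tri]
    refine tri_eq_zero (h'.rel_bbb i j k l hn) ?_ (h.rel_bbb i j k l hn)
    have key := pathSum_abb_eq_zero z (fun i j k l => B i j * B k l) hz1
      (fun i j k l => by rw [h.antisymm_b, neg_mul])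
      (fun i j k l => by rw [h.antisymm_b k l, mul_neg])
      (fun i j k l => h.comm_bb _ _ _ _)
      (fun p q i j k => by
        have h1 : ∀ i j (x y : T), A i j * (x * y) = x * (A i j * y) := fun i j x y => by
          rw [← mul_assoc, hA i j x, mul_assoc]
        have h2 := h.rel_ab' i j k
        simp only [← hA] at h2
        simp only [hz, h1, ← mul_add]
        rw [h2, mul_zero]) i j k l
      (by
        rw [← h.rel_bab i j k l hn]
        simp only [hz, ← mul_assoc, h.comm_ab])
    refine Eq.trans ?_ key
    simp only [hz]
    congr 1
    funext i j k l
    rw [hA k l, ← mul_assoc (A j k), h.comm_ab j k]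
    noncomm_ring

end Differentials

/-! ### The relations for the cocomposition -/

section PathSum

variable {I M : Type*} [AddCommMonoid M] {f : I → I → I → I → M}

theorem pathSum_swap_first (hf : ∀ i j k l, f l k j i = f i j k l) (i j k l : I) :
    pathSum f j i k l = pathSum f i j k l := by
  simp only [pathSum]
  rw [hf j l k i, hf j k l i]
  abel

theorem pathSum_swap_middle (hf : ∀ i j k l, f l k j i = f i j k l) (i j k l : I) :
    pathSum f i k j l = pathSum f i j k l := by
  simp only [pathSum]
  rw [hf j l i k, hf j i l k]
  abel

theorem pathSum_swap_last (hf : ∀ i j k l, f l k j i = f i j k l) (i j k l : I) :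
    pathSum f i j l k = pathSum f i j k l := by
  simp only [pathSum]
  rw [hf k j i l, hf k i j l]
  abel

end PathSum

section Glue

variable {I J T : Type*}

/-- The map `I ⊔ J → I ⊔ {⋆}` that sends all elements of `J` to `⋆`. -/
def collapse : I ⊕ J → Option I
  | Sum.inl i => some i
  | Sum.inr _ => none

/-- The family on `I ⊔ J` that is given by `C''` for two indices in `J`, and by the family `C'`
on `I ⊔ {⋆}` for all other pairs. -/
def glue (C' : Option I → Option I → T) (C'' : J → J → T) : I ⊕ J → I ⊕ J → T
  | Sum.inr j, Sum.inr k => C'' j k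
  | x, y => C' (collapse x) (collapse y)

variable [Ring T] {A' B' : Option I → Option I → T} {A'' B'' : J → J → T}

/-- A product over a walk in `I ⊔ J` is, up to the factors that come from the edges inside `J`,
a product over a walk in `I ⊔ {⋆}`. -/
theorem exists_walk_glue (hcomm : ∀ x y j k, SignCommute (B' x y) (B'' j k)) (x : I ⊕ J)
    (l : List (I ⊕ J)) :
    ∃ (m : List (Option I)) (Q : T), walkEnd (collapse x) m = collapse (walkEnd x l) ∧
      walk (glue B' B'') x l = walk B' (collapse x) m * Q ∧
      (m = [] → l = [] ∨ ∃ (j : J) (q : List J), x = Sum.inr j ∧ l = q.map Sum.inr) := by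
  have edge : ∀ (x y : I ⊕ J) (l : List (I ⊕ J)),
      glue B' B'' x y = B' (collapse x) (collapse y) →
      (∃ (m : List (Option I)) (Q : T), walkEnd (collapse y) m = collapse (walkEnd y l) ∧
        walk (glue B' B'') y l = walk B' (collapse y) m * Q) →
      ∃ (m : List (Option I)) (Q : T), walkEnd (collapse x) m = collapse (walkEnd y l) ∧
        glue B' B'' x y * walk (glue B' B'') y l = walk B' (collapse x) m * Q ∧ m ≠ [] := by
    rintro x y l hxy ⟨m, Q, h1, h2⟩
    exact ⟨collapse y :: m, Q, h1, by rw [hxy, h2, walk_cons, mul_assoc], by simp⟩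
  induction l generalizing x with
  | nil => exact ⟨[], 1, rfl, by simp, fun _ => Or.inl rfl⟩
  | cons y l ih =>
    obtain ⟨m, Q, h1, h2, h3⟩ := ih y
    rw [walk_cons, walkEnd_cons]
    by_cases hxy : glue B' B'' x y = B' (collapse x) (collapse y)
    · obtain ⟨m, Q, h1, h2, h3⟩ := edge x y l hxy ⟨m, Q, h1, h2⟩
      exact ⟨m, Q, h1, h2, fun h => absurd h h3⟩
    rcases x with i | j
    · exact absurd rfl hxy
    rcases y with i | k
    · exact absurd rfl hxy
    have hmove : SignCommute (B'' j k) (walk B' none m) :=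
      SignCommute.walk_right (fun _ _ => (hcomm _ _ _ _).symm) _ _
    have hfin : m = [] →
        Sum.inr k :: l = [] ∨ ∃ (j' : J) (q : List J),
          (Sum.inr j : I ⊕ J) = Sum.inr j' ∧ Sum.inr k :: l = q.map Sum.inr := by
      intro hm
      rcases h3 hm with rfl | ⟨k', q, hk, rfl⟩
      · exact Or.inr ⟨j, [k], rfl, rfl⟩
      · exact Or.inr ⟨j, k :: q, rfl, rfl⟩
    rcases hmove with hmove | hmove
    · refine ⟨m, B'' j k * Q, h1, ?_, hfin⟩
      rw [h2, ← mul_assoc]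
      change B'' j k * walk B' none m * Q = walk B' none m * (B'' j k * Q)
      rw [hmove, mul_assoc]
    · refine ⟨m, -(B'' j k * Q), h1, ?_, hfin⟩
      rw [h2, ← mul_assoc]
      change B'' j k * walk B' none m * Q = walk B' none m * -(B'' j k * Q)
      rw [hmove, mul_neg, neg_mul, mul_assoc]

variable [Algebra ℂ T]

/-- If the family `B'` satisfies the relations, then the products over cycles in `I ⊔ J` vanish
for the glued family, since a cycle that leaves `J` gives a closed walk in `I ⊔ {⋆}`. Here the
closing edge lies in a family `C`, which is either of the two families. -/
theorem glue_cycle (hI : Relations A' B')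
    (hcomm : ∀ x y j k, SignCommute (B' x y) (B'' j k))
    {C' : Option I → Option I → T} {C'' : J → J → T}
    (hC' : ∀ x l, C' (walkEnd x l) x * walk B' x l = 0)
    (hC'' : ∀ x l, C'' (walkEnd x l) x * walk B'' x l = 0)
    (x : I ⊕ J) (l : List (I ⊕ J)) (hl : l ≠ []) :
    glue C' C'' (walkEnd x l) x * walk (glue B' B'') x l = 0 := by
  obtain ⟨m, Q, h1, h2, h3⟩ := exists_walk_glue hcomm x l
  by_cases hxy : glue C' C'' (walkEnd x l) x = C' (collapse (walkEnd x l)) (collapse x)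
  · rw [hxy, h2, ← mul_assoc, ← h1, hC', zero_mul]
  cases m with
  | nil =>
    obtain rfl | ⟨j, q, rfl, rfl⟩ := h3 rfl
    · exact absurd rfl hl
    rw [walkEnd_map, ← walk_comp Sum.inr (glue B' B'')]
    exact hC'' j q
  | cons z m =>
    rcases x with i | j
    · exact absurd (by cases walkEnd (Sum.inl i) l <;> rfl) hxy
    have hend : collapse (walkEnd (Sum.inr j) l) = (none : Option I) := by
      generalize walkEnd (Sum.inr j) l = e at hxy
      rcases e with i | k
      · exact absurd rfl hxy
      · rfl
    have hzero : walk B' (collapse (Sum.inr j : I ⊕ J)) (z :: m) = 0 := by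
      have := hI.closed_b z m
      rw [walkEnd_cons] at h1
      rw [h1, hend] at this
      exact this
    rw [h2, hzero, zero_mul, mul_zero]

/-- The closed walks of lengths two and three. -/
theorem Relations.mul_rev_eq_zero (hI : Relations A' B') (x y z : Option I) :
    A' x y * B' y x = 0 ∧ B' x y * A' y x = 0 ∧ B' x y * B' y x = 0 ∧
      B' x y * (A' y z * B' z x) = 0 ∧ B' x y * (B' y z * B' z x) = 0 := by
  refine ⟨?_, ?_, ?_, ?_, ?_⟩
  · simpa using hI.closed_a y [x]
  · rw [← hI.comm_ab]; simpa using hI.closed_a x [y]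
  · simpa using hI.closed_b y [x]
  · rw [← mul_assoc, ← hI.comm_ab, mul_assoc, hI.comm_bb, mul_neg, neg_eq_zero]
    simpa using hI.closed_a z [x, y]
  · simpa using hI.closed_b y [z, x]

/-- Families on `I ⊔ {⋆}` and `J` that satisfy the relations and commute with each other in the
graded sense glue to a family on `I ⊔ J` that satisfies the relations. -/
theorem Relations.glued (hI : Relations A' B') (hJ : Relations A'' B'')
    (caa : ∀ x y j k, A' x y * A'' j k = A'' j k * A' x y)
    (cab : ∀ x y j k, A' x y * B'' j k = B'' j k * A' x y)
    (cba : ∀ x y j k, B' x y * A'' j k = A'' j k * B' x y)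
    (cbb : ∀ x y j k, B' x y * B'' j k = -(B'' j k * B' x y)) :
    Relations (glue A' A'') (glue B' B'') := by
  have z1 : ∀ x y, A' x y * B' y x = 0 := fun x y => (hI.mul_rev_eq_zero x y x).1
  have z2 : ∀ x y, B' x y * A' y x = 0 := fun x y => (hI.mul_rev_eq_zero x y x).2.1
  have z3 : ∀ x y, B' x y * B' y x = 0 := fun x y => (hI.mul_rev_eq_zero x y x).2.2.1
  have z4 : ∀ x y z, B' x y * (A' y z * B' z x) = 0 :=
    fun x y z => (hI.mul_rev_eq_zero x y z).2.2.2.1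
  have z5 : ∀ x y z, B' x y * (B' y z * B' z x) = 0 :=
    fun x y z => (hI.mul_rev_eq_zero x y z).2.2.2.2
  have cab' : ∀ x y j k, B'' j k * A' x y = A' x y * B'' j k := fun x y j k =>
    (cab x y j k).symm
  have cba' : ∀ x y j k, A'' j k * B' x y = B' x y * A'' j k := fun x y j k =>
    (cba x y j k).symm
  have cbb' : ∀ x y j k, B'' j k * B' x y = -(B' x y * B'' j k) := fun x y j k => by
    rw [cbb, neg_neg]
  have antiA : ∀ x y, glue A' A'' y x = -glue A' A'' x y := by
    rintro (i | j) (k | l) <;> first | exact hI.antisymm_a _ _ | exact hJ.antisymm_a _ _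
  have antiB : ∀ x y, glue B' B'' y x = -glue B' B'' x y := by
    rintro (i | j) (k | l) <;> first | exact hI.antisymm_b _ _ | exact hJ.antisymm_b _ _
  have commAB : ∀ x y z w,
      glue A' A'' x y * glue B' B'' z w = glue B' B'' z w * glue A' A'' x y := by
    rintro (i | i) (j | j) (k | k) (l | l) <;>
      first
      | exact hI.comm_ab _ _ _ _
      | exact hJ.comm_ab _ _ _ _
      | exact cab _ _ _ _
      | exact cba' _ _ _ _
  have commBB : ∀ x y z w,
      glue B' B'' x y * glue B' B'' z w = -(glue B' B'' z w * glue B' B'' x y) := by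
    rintro (i | i) (j | j) (k | k) (l | l) <;>
      first
      | exact hI.comm_bb _ _ _ _
      | exact hJ.comm_bb _ _ _ _
      | exact cbb _ _ _ _
      | exact cbb' _ _ _ _
  have aa : ∀ i j k, A' (some i) none * A'' j k + A'' j k * A' none (some i) +
      A' none (some i) * A' (some i) none = 0 := by
    intro i j k
    rw [hI.antisymm_a (some i) none, caa, neg_mul, hI.a_sq']
    simp
  have ab : ∀ i j k, B' (some i) none * A'' j k + B'' j k * A' none (some i) +
      B' none (some i) * A' (some i) none + A' (some i) none * B'' j k +
      A'' j k * B' none (some i) + A' none (some i) * B' (some i) none = 0 := by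
    intro i j k
    rw [z1, z2, cab', cba', hI.antisymm_a (some i) none, hI.antisymm_b (some i) none]
    simp
  -- the reversal of a path does not change the product
  have revA : ∀ i j k l, glue B' B'' l k * glue A' A'' k j * glue B' B'' j i =
      glue B' B'' i j * glue A' A'' j k * glue B' B'' k l := by
    intro i j k l
    rw [antiB k l, antiA j k, antiB i j, mul_assoc, mul_assoc, commAB j k k l,
      ← mul_assoc _ _ (glue A' A'' j k), commBB i j k l]
    simp only [neg_mul, mul_neg, neg_neg, mul_assoc, commAB]
  have revB : ∀ i j k l, glue B' B'' l k * glue B' B'' k j * glue B' B'' j i =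
      glue B' B'' i j * glue B' B'' j k * glue B' B'' k l := by
    intro i j k l
    rw [antiB k l, antiB j k, antiB i j, neg_mul_neg, mul_neg, mul_assoc (glue B' B'' i j),
      commBB j k k l, mul_neg, ← mul_assoc, commBB i j k l, neg_mul, neg_neg, mul_assoc _ _
      (glue B' B'' j k), commBB i j j k, mul_neg, ← mul_assoc]
  constructor
  · exact antiA
  · exact antiB
  · rintro (i | i) (j | j) (k | k) (l | l) <;>
      first
      | exact hI.comm_aa _ _ _ _
      | exact hJ.comm_aa _ _ _ _
      | exact caa _ _ _ _
      | exact (caa _ _ _ _).symm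
  · exact commAB
  · exact commBB
  · rintro (i | i) (j | j) _ <;> first | exact hI.a_sq' _ _ | exact hJ.a_sq' _ _
  · rintro (i | i) (j | j) (k | k) _ _ _
    · exact hI.rel_aa' _ _ _
    · exact hI.rel_aa' _ _ _
    · exact hI.rel_aa' _ _ _
    · exact aa i j k
    · exact hI.rel_aa' _ _ _
    · refine Eq.trans ?_ (aa j k i)
      simp only [glue, collapse]
      abel
    · refine Eq.trans ?_ (aa k i j)
      simp only [glue, collapse]
      abel
    · exact hJ.rel_aa' _ _ _
  · rintro (i | i) (j | j) (k | k) _ _ _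
    · exact hI.rel_ab' _ _ _
    · exact hI.rel_ab' _ _ _
    · exact hI.rel_ab' _ _ _
    · exact ab i j k
    · exact hI.rel_ab' _ _ _
    · refine Eq.trans ?_ (ab j k i)
      simp only [glue, collapse]
      abel
    · refine Eq.trans ?_ (ab k i j)
      simp only [glue, collapse]
      abel
    · exact hJ.rel_ab' _ _ _
  · exact fun x l hl _ => glue_cycle hI (fun _ _ _ _ => Or.inr (cbb _ _ _ _)) hI.closed_a
      hJ.closed_a x l hl
  · exact fun x l hl _ => glue_cycle hI (fun _ _ _ _ => Or.inr (cbb _ _ _ _)) hI.closed_b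
      hJ.closed_b x l hl
  · set f : I ⊕ J → I ⊕ J → I ⊕ J → I ⊕ J → T := fun i j k l =>
      glue B' B'' i j * glue A' A'' j k * glue B' B'' k l with hf
    have s1 := pathSum_swap_first (f := f) revA
    have s2 := pathSum_swap_middle (f := f) revA
    have s3 := pathSum_swap_last (f := f) revA
    -- it remains to treat the cases with two or three indices in `J`, in sorted order
    have two : ∀ i j k l, pathSum f (Sum.inl i) (Sum.inl j) (Sum.inr k) (Sum.inr l) = 0 := by
      intro i j k l
      simp only [pathSum, hf, glue, collapse, mul_assoc, z1, z4, mul_zero,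
        hJ.antisymm_b k l, hJ.antisymm_a k l, mul_neg, neg_mul]
      abel
    have three : ∀ i j k l, pathSum f (Sum.inl i) (Sum.inr j) (Sum.inr k) (Sum.inr l) = 0 := by
      intro i j k l
      have h1 := congrArg (B' (some i) none * ·) (hJ.rel_ab' j k l)
      simp only [← hJ.comm_ab, mul_add, mul_zero] at h1
      have z2' : ∀ x : T, B' none (some i) * (A' (some i) none * x) = 0 := fun x => by
        rw [← mul_assoc, z2, zero_mul]
      simp only [pathSum, hf, glue, collapse, mul_assoc, z1, z2', mul_zero]
      refine Eq.trans ?_ h1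
      simp only [hJ.antisymm_b j k, hJ.antisymm_a j k, hJ.antisymm_b j l, hJ.antisymm_a j l,
        hJ.antisymm_b k l, hJ.antisymm_a k l, mul_neg, neg_mul]
      abel
    rintro (i | i) (j | j) (k | k) (l | l) hn
    · exact hI.rel_bab (some i) (some j) (some k) (some l)
        (by simpa using hn)
    · exact hI.rel_bab (some i) (some j) (some k) none (by simpa using hn)
    · exact hI.rel_bab (some i) (some j) none (some l) (by simpa using hn)
    · exact two i j k l
    · exact hI.rel_bab (some i) none (some k) (some l) (by simpa using hn)
    · rw [s2]; exact two i k j l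
    · rw [s3, s2]; exact two i l j k
    · exact three i j k l
    · exact hI.rel_bab none (some j) (some k) (some l) (by simpa using hn)
    · rw [s1, s2]; exact two j k i l
    · rw [s1, s3, s2]; exact two j l i k
    · rw [s1]; exact three j i k l
    · rw [s2, s1, s3, s2]; exact two k l i j
    · rw [s2, s1]; exact three k i j l
    · rw [s3, s2, s1]; exact three l i j k
    · exact hJ.rel_bab i j k l (by simpa using hn)
  · set f : I ⊕ J → I ⊕ J → I ⊕ J → I ⊕ J → T := fun i j k l =>
      glue B' B'' i j * glue B' B'' j k * glue B' B'' k l with hf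
    have s1 := pathSum_swap_first (f := f) revB
    have s2 := pathSum_swap_middle (f := f) revB
    have s3 := pathSum_swap_last (f := f) revB
    have two : ∀ i j k l, pathSum f (Sum.inl i) (Sum.inl j) (Sum.inr k) (Sum.inr l) = 0 := by
      intro i j k l
      simp only [pathSum, hf, glue, collapse, mul_assoc, z3, z5, mul_zero,
        hJ.antisymm_b k l, mul_neg, neg_mul]
      abel
    have three : ∀ i j k l, pathSum f (Sum.inl i) (Sum.inr j) (Sum.inr k) (Sum.inr l) = 0 := by
      intro i j k l
      have z3' : ∀ x : T, B' none (some i) * (B' (some i) none * x) = 0 := fun x => by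
        rw [← mul_assoc, z3, zero_mul]
      simp only [pathSum, hf, glue, collapse, mul_assoc, z3, z3', mul_zero]
      simp only [hJ.antisymm_b j k, hJ.antisymm_b j l, hJ.antisymm_b k l, mul_neg, neg_mul,
        hJ.comm_bb k l j k, hJ.comm_bb k l j l, hJ.comm_bb j l j k]
      abel
    rintro (i | i) (j | j) (k | k) (l | l) hn
    · exact hI.rel_bbb (some i) (some j) (some k) (some l) (by simpa using hn)
    · exact hI.rel_bbb (some i) (some j) (some k) none (by simpa using hn)
    · exact hI.rel_bbb (some i) (some j) none (some l) (by simpa using hn)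
    · exact two i j k l
    · exact hI.rel_bbb (some i) none (some k) (some l) (by simpa using hn)
    · rw [s2]; exact two i k j l
    · rw [s3, s2]; exact two i l j k
    · exact three i j k l
    · exact hI.rel_bbb none (some j) (some k) (some l) (by simpa using hn)
    · rw [s1, s2]; exact two j k i l
    · rw [s1, s3, s2]; exact two j l i k
    · rw [s1]; exact three j i k l
    · rw [s2, s1, s3, s2]; exact two k l i j
    · rw [s2, s1]; exact three k i j l
    · rw [s3, s2, s1]; exact three l i j k
    · exact hJ.rel_bbb i j k l (by simpa using hn)

end Glue

end RAlg

namespace BigradedAlg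

/-! ### Koszul signs and multiplication in tensor products -/

theorem units_smul_eq {M : Type*} [AddCommGroup M] [Module ℂ M] (v : ℤˣ) (x : M) :
    v • x = ((v : ℤ) : ℂ) • x := by
  rw [Units.smul_def, Int.cast_smul_eq_zsmul]

variable (A B C : BigradedAlg.{u})

/-- The Koszul sign is multiplicative, since the first degree is additive. -/
theorem koszulSign_mul (x y : A) :
    A.koszulSign (x * y) = A.koszulSign x * A.koszulSign y := by
  induction x using DirectSum.Decomposition.inductionOn A.gr with
  | zero => simp
  | add x x' hx hx' => rw [add_mul, map_add, hx, hx', map_add, add_mul]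
  | @homogeneous m x =>
    induction y using DirectSum.Decomposition.inductionOn A.gr with
    | zero => simp
    | add y y' hy hy' => rw [mul_add, map_add, hy, hy', map_add, mul_add]
    | @homogeneous n y =>
      rw [A.koszulSign_apply m x x.2, A.koszulSign_apply n y y.2,
        A.koszulSign_apply (m + n) _ (SetLike.mul_mem_graded x.2 y.2), Prod.fst_add,
        Int.negOnePow_add, smul_mul_smul_comm, Units.val_mul, Int.cast_mul]

theorem koszulSign_one : A.koszulSign 1 = 1 := by
  rw [A.koszulSign_apply 0 1 SetLike.GradedOne.one_mem]
  simp

theorem koszulSign_koszulSign (x : A) : A.koszulSign (A.koszulSign x) = x := by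
  induction x using DirectSum.Decomposition.inductionOn A.gr with
  | zero => simp
  | add x x' hx hx' => rw [map_add, map_add, hx, hx']
  | @homogeneous m x =>
    rw [A.koszulSign_apply m x x.2, map_smul, A.koszulSign_apply m x x.2, smul_smul,
      ← Int.cast_mul, ← Units.val_mul, Int.units_mul_self]
    simp

/-- The involution `koszulSign` or the identity, according to the parity `e`: the sign that
comes from moving an element of parity `e` past the elements of `A`. -/
def twist (e : Bool) : A →ₗ[ℂ] A := if e then A.koszulSign else LinearMap.id

@[simp] theorem twist_false : A.twist false = LinearMap.id := rfl

@[simp] theorem twist_true : A.twist true = A.koszulSign := rfl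

/-- The first degree `0` or `1` with parity `e`. The elements that are moved past others below
are generators, whose first degree is `0` or `1`. -/
def parityDeg (e : Bool) : ℤ := if e then 1 else 0

variable {A B C}

/-- Left multiplication by `c ⊗ 1`. -/
theorem unTensor_tmul_one_mul (c : A) (t : A.Tensor B) :
    unTensor A B (GradedTensorProduct.tmul ℂ c (1 : B) * t) =
      TensorProduct.map (LinearMap.mulLeft ℂ c) LinearMap.id (unTensor A B t) := by
  obtain ⟨t, rfl⟩ := (GradedTensorProduct.of ℂ A.gr B.gr).surjective t
  induction t using TensorProduct.induction_on with
  | zero => simp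
  | add t t' ht ht' => rw [map_add, mul_add, map_add, ht, ht', map_add, map_add]
  | tmul x y =>
    induction x using DirectSum.Decomposition.inductionOn A.gr with
    | zero => simp
    | add x x' hx hx' =>
      rw [TensorProduct.add_tmul, map_add, mul_add, map_add, hx, hx', map_add, map_add]
    | @homogeneous m x =>
      refine (congrArg (unTensor A B)
        (GradedTensorProduct.tmul_one_mul_coe_tmul A.gr B.gr c x y)).trans ?_
      rfl

/-- Left multiplication by `1 ⊗ c`. -/
theorem unTensor_one_tmul_mul {e : Bool} {q : ℤ} {c : B} (hc : c ∈ B.gr (parityDeg e, q))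
    (t : A.Tensor B) :
    unTensor A B (GradedTensorProduct.tmul ℂ (1 : A) c * t) =
      TensorProduct.map (A.twist e) (LinearMap.mulLeft ℂ c) (unTensor A B t) := by
  obtain ⟨t, rfl⟩ := (GradedTensorProduct.of ℂ A.gr B.gr).surjective t
  induction t using TensorProduct.induction_on with
  | zero => simp
  | add t t' ht ht' => rw [map_add, mul_add, map_add, ht, ht', map_add, map_add]
  | tmul x y =>
    induction x using DirectSum.Decomposition.inductionOn A.gr with
    | zero => simp
    | add x x' hx hx' =>
      rw [TensorProduct.add_tmul, map_add, mul_add, map_add, hx, hx', map_add, map_add]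
    | @homogeneous m x =>
      refine (congrArg (unTensor A B)
        (GradedTensorProduct.tmul_coe_mul_coe_tmul A.gr B.gr (1 : A) ⟨c, hc⟩ x y)).trans ?_
      rw [one_mul]
      have hs : ((((-1 : ℤˣ) ^ ((parityDeg e, q) * m : ℤ × ℤ) : ℤˣ) : ℤ) : ℂ) • (x : A) =
          A.twist e x := by
        rw [neg_one_uzpow_bidegree]
        cases e
        · simp [parityDeg]
        · rw [twist_true, A.koszulSign_apply m x x.2]
          simp [parityDeg, Int.negOnePow]
      rw [units_smul_eq, map_smul]
      change _ • ((x : A) ⊗ₜ[ℂ] (c * y)) = A.twist e x ⊗ₜ[ℂ] (c * y)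
      rw [← hs, TensorProduct.smul_tmul']

theorem twist_mem {e : Bool} {n : ℤ × ℤ} {x : A} (hx : x ∈ A.gr n) : A.twist e x ∈ A.gr n := by
  cases e
  · exact hx
  · rw [twist_true, A.koszulSign_apply n x hx]
    exact Submodule.smul_mem _ _ hx

/-- Left multiplication by `c ⊗ 1` on `A ⊗ B`. -/
def opL (A B : BigradedAlg.{u}) (c : A) : A ⊗[ℂ] B →ₗ[ℂ] A ⊗[ℂ] B :=
  TensorProduct.map (LinearMap.mulLeft ℂ c) LinearMap.id

/-- Left multiplication by `1 ⊗ c` on `A ⊗ B`, for `c` of parity `e`. -/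
def opR (A B : BigradedAlg.{u}) (e : Bool) (c : B) : A ⊗[ℂ] B →ₗ[ℂ] A ⊗[ℂ] B :=
  TensorProduct.map (A.twist e) (LinearMap.mulLeft ℂ c)

@[simp] theorem opL_tmul (c x : A) (y : B) : opL A B c (x ⊗ₜ[ℂ] y) = (c * x) ⊗ₜ[ℂ] y := rfl

@[simp] theorem opR_tmul (e : Bool) (c : B) (x : A) (y : B) :
    opR A B e c (x ⊗ₜ[ℂ] y) = A.twist e x ⊗ₜ[ℂ] (c * y) := rfl

theorem opL_mem {k n : ℤ × ℤ} {c : A} (hc : c ∈ A.gr k) {t : A ⊗[ℂ] B}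
    (ht : t ∈ tensorGr A B n) : opL A B c t ∈ tensorGr A B (k + n) := by
  induction ht using Submodule.span_induction with
  | mem t ht =>
    obtain ⟨p, q, x, y, hx, hy, rfl, rfl⟩ := ht
    exact Submodule.subset_span
      ⟨k + p, q, c * x, y, SetLike.mul_mem_graded hc hx, hy, add_assoc _ _ _, rfl⟩
  | zero => rw [map_zero]; exact Submodule.zero_mem _
  | add t t' _ _ h h' => rw [map_add]; exact Submodule.add_mem _ h h'
  | smul r t _ h => rw [map_smul]; exact Submodule.smul_mem _ _ h

theorem opR_mem {k n : ℤ × ℤ} {e : Bool} {c : B} (hc : c ∈ B.gr k) {t : A ⊗[ℂ] B}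
    (ht : t ∈ tensorGr A B n) : opR A B e c t ∈ tensorGr A B (k + n) := by
  induction ht using Submodule.span_induction with
  | mem t ht =>
    obtain ⟨p, q, x, y, hx, hy, rfl, rfl⟩ := ht
    exact Submodule.subset_span
      ⟨p, k + q, _, c * y, twist_mem hx, SetLike.mul_mem_graded hc hy, add_left_comm _ _ _, rfl⟩
  | zero => rw [map_zero]; exact Submodule.zero_mem _
  | add t t' _ _ h h' => rw [map_add]; exact Submodule.add_mem _ h h'
  | smul r t _ h => rw [map_smul]; exact Submodule.smul_mem _ _ h

theorem comm_tmul_one (c : A) :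
    GradedTensorProduct.comm A.gr B.gr (GradedTensorProduct.tmul ℂ c (1 : B)) =
      GradedTensorProduct.tmul ℂ (1 : B) c := by
  induction c using DirectSum.Decomposition.inductionOn A.gr with
  | zero =>
    change GradedTensorProduct.comm A.gr B.gr (GradedTensorProduct.of ℂ A.gr B.gr (0 ⊗ₜ[ℂ] 1)) =
      GradedTensorProduct.of ℂ B.gr A.gr (1 ⊗ₜ[ℂ] 0)
    simp
  | add x x' hx hx' =>
    change GradedTensorProduct.comm A.gr B.gr
      (GradedTensorProduct.of ℂ A.gr B.gr ((x + x') ⊗ₜ[ℂ] 1)) =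
      GradedTensorProduct.of ℂ B.gr A.gr (1 ⊗ₜ[ℂ] (x + x'))
    rw [TensorProduct.add_tmul, TensorProduct.tmul_add, map_add, map_add, map_add]
    exact congrArg₂ (· + ·) hx hx'
  | @homogeneous m x =>
    have h := GradedTensorProduct.comm_coe_tmul_coe (R := ℂ) A.gr B.gr x
      (⟨1, SetLike.GradedOne.one_mem⟩ : B.gr 0)
    rw [zero_mul, uzpow_zero, one_smul] at h
    exact h

theorem comm_one_tmul (c : B) :
    GradedTensorProduct.comm A.gr B.gr (GradedTensorProduct.tmul ℂ (1 : A) c) =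
      GradedTensorProduct.tmul ℂ c (1 : A) := by
  induction c using DirectSum.Decomposition.inductionOn B.gr with
  | zero =>
    change GradedTensorProduct.comm A.gr B.gr (GradedTensorProduct.of ℂ A.gr B.gr (1 ⊗ₜ[ℂ] 0)) =
      GradedTensorProduct.of ℂ B.gr A.gr (0 ⊗ₜ[ℂ] 1)
    simp
  | add x x' hx hx' =>
    change GradedTensorProduct.comm A.gr B.gr
      (GradedTensorProduct.of ℂ A.gr B.gr (1 ⊗ₜ[ℂ] (x + x'))) =
      GradedTensorProduct.of ℂ B.gr A.gr ((x + x') ⊗ₜ[ℂ] 1)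
    rw [TensorProduct.add_tmul, TensorProduct.tmul_add, map_add, map_add, map_add]
    exact congrArg₂ (· + ·) hx hx'
  | @homogeneous m x =>
    have h := GradedTensorProduct.comm_coe_tmul_coe (R := ℂ) A.gr B.gr
      (⟨1, SetLike.GradedOne.one_mem⟩ : A.gr 0) x
    rw [mul_zero, uzpow_zero, one_smul] at h
    exact h

theorem tau_opL {e : Bool} {q : ℤ} {c : A} (hc : c ∈ A.gr (parityDeg e, q)) (t : A ⊗[ℂ] B) :
    tau A B (opL A B c t) = opR B A e c (tau A B t) := by
  have h := unTensor_tmul_one_mul c (GradedTensorProduct.of ℂ A.gr B.gr t)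
  have h' : GradedTensorProduct.of ℂ A.gr B.gr (opL A B c t) =
      GradedTensorProduct.tmul ℂ c (1 : B) * GradedTensorProduct.of ℂ A.gr B.gr t :=
    h.symm
  change unTensor B A (GradedTensorProduct.comm A.gr B.gr
    (GradedTensorProduct.of ℂ A.gr B.gr (opL A B c t))) = _
  rw [h', map_mul, comm_tmul_one, unTensor_one_tmul_mul hc]
  rfl

theorem tau_opR {e : Bool} {q : ℤ} {c : B} (hc : c ∈ B.gr (parityDeg e, q)) (t : A ⊗[ℂ] B) :
    tau A B (opR A B e c t) = opL B A c (tau A B t) := by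
  have h := unTensor_one_tmul_mul hc (GradedTensorProduct.of ℂ A.gr B.gr t)
  have h' : GradedTensorProduct.of ℂ A.gr B.gr (opR A B e c t) =
      GradedTensorProduct.tmul ℂ (1 : A) c * GradedTensorProduct.of ℂ A.gr B.gr t :=
    h.symm
  change unTensor B A (GradedTensorProduct.comm A.gr B.gr
    (GradedTensorProduct.of ℂ A.gr B.gr (opR A B e c t))) = _
  rw [h', map_mul, comm_one_tmul, unTensor_tmul_one_mul]
  rfl

theorem tau_one : tau A B (1 ⊗ₜ[ℂ] 1) = 1 ⊗ₜ[ℂ] 1 := by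
  change unTensor B A (GradedTensorProduct.comm A.gr B.gr 1) = _
  rw [map_one]
  rfl

/-- The sign of the parity `e`. -/
def paritySign (e : Bool) : ℂ := if e then -1 else 1

theorem koszulSign_of_mem {e : Bool} {q : ℤ} {c : A} (hc : c ∈ A.gr (parityDeg e, q)) :
    A.koszulSign c = paritySign e • c := by
  rw [A.koszulSign_apply _ c hc]
  cases e <;> simp [parityDeg, paritySign]

/-- The Leibniz rule for the product of `c ⊗ 1` with an element of `A ⊗ B`. -/
theorem tensorD_opL {dA : A →ₗ[ℂ] A} {dB : B →ₗ[ℂ] B} {e : Bool} {c : A}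
    (hc : A.koszulSign c = paritySign e • c)
    (hd : ∀ x, dA (c * x) = dA c * x + paritySign e • (c * dA x)) (t : A ⊗[ℂ] B) :
    tensorD A B dA dB (opL A B c t) =
      opL A B (dA c) t + paritySign e • opL A B c (tensorD A B dA dB t) := by
  induction t using TensorProduct.induction_on with
  | zero => simp
  | add t t' ht ht' => simp only [map_add, smul_add, ht, ht']; abel
  | tmul x y =>
    simp only [tensorD, opL_tmul, LinearMap.add_apply, TensorProduct.map_tmul, LinearMap.id_apply,
      map_add, hd, koszulSign_mul, hc, TensorProduct.add_tmul, smul_add,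
      ← TensorProduct.smul_tmul', smul_mul_assoc]
    abel

/-- The Leibniz rule for the product of `1 ⊗ c` with an element of `A ⊗ B`. -/
theorem tensorD_opR {dA : A →ₗ[ℂ] A} {dB : B →ₗ[ℂ] B} {e : Bool} {c : B}
    (hA : ∀ x, dA (A.koszulSign x) = -A.koszulSign (dA x))
    (hd : ∀ y, dB (c * y) = dB c * y + paritySign e • (c * dB y)) (t : A ⊗[ℂ] B) :
    tensorD A B dA dB (opR A B e c t) =
      opR A B (!e) (dB c) t + paritySign e • opR A B e c (tensorD A B dA dB t) := by
  induction t using TensorProduct.induction_on with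
  | zero => simp
  | add t t' ht ht' => simp only [map_add, smul_add, ht, ht']; abel
  | tmul x y =>
    cases e
    · simp only [tensorD, opR_tmul, LinearMap.add_apply, TensorProduct.map_tmul, LinearMap.id_apply,
        map_add, hd, TensorProduct.tmul_add, smul_add, Bool.not_false,
        twist_false, twist_true, paritySign, Bool.false_eq_true, if_false, one_smul]
      abel
    · simp only [tensorD, opR_tmul, LinearMap.add_apply, TensorProduct.map_tmul, LinearMap.id_apply,
        map_add, hd, hA, TensorProduct.tmul_add, smul_add, Bool.not_true,
        twist_false, twist_true, koszulSign_koszulSign, paritySign, if_true, neg_smul, one_smul,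
        TensorProduct.neg_tmul, TensorProduct.tmul_neg]
      abel

theorem map_koszulSign_opL {r : ℂ} {c : A} (hc : A.koszulSign c = r • c) (t : A ⊗[ℂ] B) :
    TensorProduct.map A.koszulSign B.koszulSign (opL A B c t) =
      r • opL A B c (TensorProduct.map A.koszulSign B.koszulSign t) := by
  induction t using TensorProduct.induction_on with
  | zero => simp
  | add t t' ht ht' => simp only [map_add, smul_add, ht, ht']
  | tmul x y =>
    simp only [opL_tmul, TensorProduct.map_tmul, koszulSign_mul, hc, smul_mul_assoc,
      TensorProduct.smul_tmul']

theorem map_koszulSign_opR {r : ℂ} {e : Bool} {c : B} (hc : B.koszulSign c = r • c)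
    (t : A ⊗[ℂ] B) :
    TensorProduct.map A.koszulSign B.koszulSign (opR A B e c t) =
      r • opR A B e c (TensorProduct.map A.koszulSign B.koszulSign t) := by
  induction t using TensorProduct.induction_on with
  | zero => simp
  | add t t' ht ht' => simp only [map_add, smul_add, ht, ht']
  | tmul x y =>
    cases e <;>
    simp only [opR_tmul, TensorProduct.map_tmul, koszulSign_mul, hc, smul_mul_assoc,
      TensorProduct.tmul_smul, twist_false, twist_true, LinearMap.id_apply]

section MapOp

variable {V W : Type*} [AddCommMonoid V] [Module ℂ V] [AddCommMonoid W] [Module ℂ W]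

theorem map_opL (F : A →ₗ[ℂ] V) (G : B →ₗ[ℂ] W) (L : V →ₗ[ℂ] V) (c : A)
    (hF : ∀ x, F (c * x) = L (F x)) (t : A ⊗[ℂ] B) :
    TensorProduct.map F G (opL A B c t) =
      TensorProduct.map L LinearMap.id (TensorProduct.map F G t) := by
  induction t using TensorProduct.induction_on with
  | zero => simp
  | add t t' ht ht' => simp only [map_add, ht, ht']
  | tmul x y => simp only [opL_tmul, TensorProduct.map_tmul, hF, LinearMap.id_apply]

theorem map_opR (F : A →ₗ[ℂ] V) (G : B →ₗ[ℂ] W) (S : V →ₗ[ℂ] V) (L : W →ₗ[ℂ] W) (e : Bool)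
    (c : B) (hF : ∀ x, F (A.twist e x) = S (F x)) (hG : ∀ y, G (c * y) = L (G y))
    (t : A ⊗[ℂ] B) :
    TensorProduct.map F G (opR A B e c t) =
      TensorProduct.map S L (TensorProduct.map F G t) := by
  induction t using TensorProduct.induction_on with
  | zero => simp
  | add t t' ht ht' => simp only [map_add, ht, ht']
  | tmul x y => simp only [opR_tmul, TensorProduct.map_tmul, hF, hG]

end MapOp

end BigradedAlg

theorem Bidifferential.d_koszulSign {A : BigradedAlg.{u}} (D : Bidifferential A) (x : A) :
    D.d (A.koszulSign x) = -A.koszulSign (D.d x) := by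
  induction x using DirectSum.Decomposition.inductionOn A.gr with
  | zero => simp
  | add x x' hx hx' => simp only [map_add, hx, hx', neg_add]
  | @homogeneous m x =>
    rw [A.koszulSign_apply m x x.2, A.koszulSign_apply _ _ (D.d_mem m.1 m.2 x x.2), map_smul,
      Int.negOnePow_succ]
    simp

theorem Bidifferential.dPrime_koszulSign {A : BigradedAlg.{u}} (D : Bidifferential A) (x : A) :
    D.dPrime (A.koszulSign x) = -A.koszulSign (D.dPrime x) := by
  induction x using DirectSum.Decomposition.inductionOn A.gr with
  | zero => simp
  | add x x' hx hx' => simp only [map_add, hx, hx', neg_add]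
  | @homogeneous m x =>
    rw [A.koszulSign_apply m x x.2, A.koszulSign_apply _ _ (D.dPrime_mem m.1 m.2 x x.2), map_smul,
      Int.negOnePow_sub, Int.negOnePow_one]
    simp

namespace R

open BigradedAlg RAlg

/-! ### Generators and homogeneous elements of `R I` -/

variable {I : Type u} [Finite I]

/-- The generator of parity `e`, that is, `a i j` or `b i j`. -/
def gen : Bool → I → I → R I
  | false => a
  | true => b

theorem relations (I : Type u) [Finite I] : Relations (a : I → I → R I) b := relations_mk I

theorem gen_mem (e : Bool) (i j : I) : gen e i j ∈ (R I).gr (parityDeg e, 1) := by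
  cases e
  · exact ⟨_, fa_mem i j, rfl⟩
  · exact ⟨_, fb_mem i j, rfl⟩

theorem koszulSign_gen (e : Bool) (i j : I) :
    (R I).koszulSign (gen e i j) = paritySign e • gen e i j :=
  koszulSign_of_mem (gen_mem e i j)

theorem gen_swap (e : Bool) (i j : I) : gen e j i = -gen e i j := by
  cases e
  · exact (relations I).antisymm_a i j
  · exact (relations I).antisymm_b i j

theorem gen_self (e : Bool) (i : I) : gen e i i = 0 := by
  cases e
  · exact (relations I).a_self i
  · exact (relations I).b_self i

/-- Induction on homogeneous elements, by left multiplication with generators. -/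
theorem gr_induction {P : ℤ × ℤ → R I → Prop} (one : P 0 1)
    (mul : ∀ e i j n x, x ∈ (R I).gr n → P n x → P ((parityDeg e, 1) + n) (gen e i j * x))
    (zero : ∀ n, P n 0) (add : ∀ n x y, P n x → P n y → P n (x + y))
    (smul : ∀ n (c : ℂ) x, P n x → P n (c • x)) {n : ℤ × ℤ} {x : R I}
    (hx : x ∈ (R I).gr n) : P n x := by
  obtain ⟨x, hx, rfl⟩ := hx
  change P n (RAlg.mk I x)
  induction hx using Submodule.span_induction with
  | mem x hx =>
    obtain ⟨w, rfl, rfl⟩ := hx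
    induction w with
    | nil => simpa using one
    | cons g w ih =>
      rw [List.map_cons, List.map_cons, List.sum_cons, List.prod_cons, map_mul]
      have hw : RAlg.mk I (w.map (FreeAlgebra.ι ℂ)).prod ∈ (R I).gr (w.map Gen.deg).sum :=
        ⟨_, Submodule.subset_span ⟨w, rfl, rfl⟩, rfl⟩
      cases g with
      | a i j => exact mul false i j _ _ hw ih
      | b i j => exact mul true i j _ _ hw ih
  | zero => rw [map_zero]; exact zero n
  | add x y _ _ hx hy => rw [map_add]; exact add n _ _ hx hy
  | smul c x _ hx => rw [map_smul]; exact smul n c _ hx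

/-- Linear maps out of `R I` agree if they agree on `1` and left multiplication with a
generator preserves agreement. -/
theorem linear_ext {V : Type*} [AddCommMonoid V] [Module ℂ V] {F G : R I →ₗ[ℂ] V}
    (one : F 1 = G 1)
    (mul : ∀ e i j x, F x = G x → F (gen e i j * x) = G (gen e i j * x)) : F = G := by
  ext x
  induction x using DirectSum.Decomposition.inductionOn (R I).gr with
  | zero => rw [map_zero, map_zero]
  | add x y hx hy => rw [map_add, map_add, hx, hy]
  | homogeneous x =>
    exact gr_induction (P := fun _ x => F x = G x) one (fun e i j _ x _ => mul e i j x)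
      (fun _ => by rw [map_zero, map_zero]) (fun _ x y hx hy => by rw [map_add, map_add, hx, hy])
      (fun _ c x hx => by rw [map_smul, map_smul, hx]) x.2

theorem algHom_ext {T : Type*} [Ring T] [Algebra ℂ T] {F G : R I →ₐ[ℂ] T}
    (h : ∀ e (i j : I), i ≠ j → F (gen e i j) = G (gen e i j)) : F = G := by
  have : F.toLinearMap = G.toLinearMap := by
    refine linear_ext ?_ fun e i j x hx => ?_
    · exact (map_one F).trans (map_one G).symm
    · have hg : F (gen e i j) = G (gen e i j) := by
        by_cases hij : i = j
        · rw [hij, gen_self, map_zero, map_zero]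
        · exact h e i j hij
      have hx' : F x = G x := hx
      change F (gen e i j * x) = G (gen e i j * x)
      rw [map_mul, map_mul, hg, hx']
  exact AlgHom.toLinearMap_injective this

theorem a_mul_comm (i j : I) (x : R I) : a i j * x = x * a i j := by
  have : LinearMap.mulLeft ℂ (a i j) = LinearMap.mulRight ℂ (a i j) := by
    refine linear_ext (by simp) fun e k l x hx => ?_
    simp only [LinearMap.mulLeft_apply, LinearMap.mulRight_apply] at hx ⊢
    have hg : a i j * gen e k l = gen e k l * a i j := by
      cases e
      · exact (relations I).comm_aa i j k l
      · exact (relations I).comm_ab i j k l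
    rw [← mul_assoc, hg, mul_assoc, hx, mul_assoc]
  exact LinearMap.congr_fun this x

/-! ### The differentials of `R I` -/

/-- The algebra map `x ↦ tri (s x) (d x) x` for the differential `d` (if `k` is `false`) or
`d'` (if `k` is `true`), with `s` the Koszul sign. -/
def diffHom (I : Type u) [Finite I] : Bool → (R I →ₐ[ℂ] Matrix (Fin 2) (Fin 2) (R I))
  | false => (relations I).tri_d.lift
  | true => ((relations I).tri_dPrime a_mul_comm).lift

/-- The differential `d` (if `k` is `false`) or `d'` (if `k` is `true`): it exchanges the
generators of parity `k` with those of the other parity, and kills the latter. -/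
def diff (I : Type u) [Finite I] (k : Bool) : R I →ₗ[ℂ] R I :=
  Matrix.entryLinearMap ℂ (R I) 0 1 ∘ₗ (diffHom I k).toLinearMap

theorem diffHom_gen (k e : Bool) (i j : I) :
    diffHom I k (gen e i j) =
      tri (paritySign e • gen e i j) (if e = k then gen (!e) i j else 0) (gen e i j) := by
  cases k <;> cases e
  · refine ((relations I).tri_d.lift_mk (fa i j)).trans ((freeLift_fa _ _ i j).trans ?_)
    exact tri_congr (one_smul ℂ _).symm rfl rfl
  · refine ((relations I).tri_d.lift_mk (fb i j)).trans ((freeLift_fb _ _ i j).trans ?_)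
    exact tri_congr (neg_one_smul ℂ _).symm rfl rfl
  · refine (((relations I).tri_dPrime a_mul_comm).lift_mk (fa i j)).trans
      ((freeLift_fa _ _ i j).trans ?_)
    exact tri_congr (one_smul ℂ _).symm rfl rfl
  · refine (((relations I).tri_dPrime a_mul_comm).lift_mk (fb i j)).trans
      ((freeLift_fb _ _ i j).trans ?_)
    exact tri_congr (neg_one_smul ℂ _).symm rfl rfl

theorem diff_gen (k e : Bool) (i j : I) :
    diff I k (gen e i j) = if e = k then gen (!e) i j else 0 := by
  change diffHom I k (gen e i j) 0 1 = _
  rw [diffHom_gen]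
  rfl

theorem diff_one (k : Bool) : diff I k 1 = 0 := by
  change diffHom I k 1 0 1 = _
  rw [map_one]
  rfl

theorem diffHom_apply (k : Bool) (x : R I) :
    diffHom I k x = tri ((R I).koszulSign x) (diff I k x) x := by
  let G : R I →ₗ[ℂ] Matrix (Fin 2) (Fin 2) (R I) :=
    { toFun := fun x => tri ((R I).koszulSign x) (diff I k x) x
      map_add' := fun x y => by rw [map_add, map_add, tri_add]
      map_smul' := fun c x => by rw [map_smul, map_smul, RingHom.id_apply, tri_smul] }
  have : (diffHom I k).toLinearMap = G := by
    refine linear_ext ?_ fun e i j x hx => ?_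
    · change diffHom I k 1 = tri ((R I).koszulSign 1) (diff I k 1) 1
      rw [map_one, koszulSign_one, diff_one, tri_one]
    · replace hx : diffHom I k x = tri ((R I).koszulSign x) (diff I k x) x := hx
      change diffHom I k (gen e i j * x) = tri ((R I).koszulSign (gen e i j * x))
        (diffHom I k (gen e i j * x) 0 1) (gen e i j * x)
      rw [map_mul, diffHom_gen, hx, tri_mul, koszulSign_mul, koszulSign_gen]
      rfl
  exact LinearMap.congr_fun this x

theorem diff_mul (k : Bool) (x y : R I) :
    diff I k (x * y) = diff I k x * y + (R I).koszulSign x * diff I k y := by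
  change diffHom I k (x * y) 0 1 = _
  rw [map_mul, diffHom_apply, diffHom_apply, tri_mul, add_comm]
  rfl

theorem diff_gen_mul (k e : Bool) (i j : I) (x : R I) :
    diff I k (gen e i j * x) = (if e = k then gen (!e) i j else 0) * x +
      paritySign e • (gen e i j * diff I k x) := by
  rw [diff_mul, diff_gen, koszulSign_gen, smul_mul_assoc]

theorem diff_mem (k : Bool) {n : ℤ × ℤ} {x : R I} (hx : x ∈ (R I).gr n) :
    diff I k x ∈ (R I).gr ((if k then -1 else 1, 0) + n) := by
  refine gr_induction (P := fun n x => diff I k x ∈ (R I).gr ((if k then -1 else 1, 0) + n))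
    ?_ ?_ ?_ ?_ ?_ hx
  · rw [diff_one]; exact Submodule.zero_mem _
  · intro e i j n x hxn hx
    rw [diff_gen_mul]
    refine Submodule.add_mem _ ?_ (Submodule.smul_mem _ _ ?_)
    · by_cases h : e = k
      · rw [if_pos h]
        have hg : gen (!e) i j ∈ (R I).gr ((if k then -1 else 1, 0) + (parityDeg e, 1)) := by
          subst h
          cases e
          · exact gen_mem true i j
          · exact gen_mem false i j
        rw [← add_assoc]
        exact SetLike.mul_mem_graded hg hxn
      · rw [if_neg h, zero_mul]; exact Submodule.zero_mem _
    · rw [add_left_comm]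
      exact SetLike.mul_mem_graded (gen_mem e i j) hx
  · intro n
    rw [map_zero]; exact Submodule.zero_mem _
  · intro n x y hx hy
    rw [map_add]; exact Submodule.add_mem _ hx hy
  · intro n c x hx
    rw [map_smul]; exact Submodule.smul_mem _ _ hx

theorem diff_diff (k : Bool) (x : R I) : diff I k (diff I k x) = 0 := by
  have : diff I k ∘ₗ diff I k = 0 := by
    refine linear_ext ?_ fun e i j x hx => ?_
    · rw [LinearMap.comp_apply, diff_one, map_zero, LinearMap.zero_apply]
    · rw [LinearMap.zero_apply, LinearMap.comp_apply] at hx ⊢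
      rw [diff_gen_mul, map_add, map_smul, diff_gen_mul, hx]
      by_cases h : e = k
      · subst h
        rw [if_pos rfl, diff_gen_mul, if_neg (by cases e <;> simp), zero_mul, zero_add,
          mul_zero, smul_zero, add_zero, ← add_smul]
        cases e <;> simp [paritySign]
      · rw [if_neg h, zero_mul, map_zero, zero_add, mul_zero, smul_zero, add_zero,
          zero_mul, smul_zero]
  exact LinearMap.congr_fun this x

/-- The bidifferential structure of `R I`. -/
def bidiff (I : Type u) [Finite I] : Bidifferential (R I) where
  d := diff I false
  dPrime := diff I true
  d_mem p q x hx := by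
    have := diff_mem false hx
    simpa [add_comm] using this
  dPrime_mem p q x hx := by
    have := diff_mem true hx
    simpa [add_comm, sub_eq_add_neg] using this
  d_mul p q x y hx := by
    rw [diff_mul, koszulSign_apply _ _ x hx, smul_mul_assoc]
  dPrime_mul p q x y hx := by
    rw [diff_mul, koszulSign_apply _ _ x hx, smul_mul_assoc]
  d_d := diff_diff false
  dPrime_dPrime := diff_diff true

theorem diff_koszulSign (k : Bool) (x : R I) :
    diff I k ((R I).koszulSign x) = -(R I).koszulSign (diff I k x) := by
  cases k
  · exact (bidiff I).d_koszulSign x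
  · exact (bidiff I).dPrime_koszulSign x

end R

namespace R

open BigradedAlg RAlg

variable {I I' I'' J J' K : Type u} [Finite I] [Finite I'] [Finite I''] [Finite J] [Finite J']
  [Finite K]

/-! ### The action of bijections -/

/-- The algebra map `R I → R I'` induced by a bijection. -/
def relabel (σ : I ≃ I') : R I →ₐ[ℂ] R I' := ((relations I').comp σ σ.injective).lift

theorem relabel_gen (σ : I ≃ I') (e : Bool) (i j : I) :
    relabel σ (gen e i j) = gen e (σ i) (σ j) := by
  cases e
  · exact (Relations.lift_mk _ (fa i j)).trans (freeLift_fa _ _ i j)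
  · exact (Relations.lift_mk _ (fb i j)).trans (freeLift_fb _ _ i j)

theorem relabel_gen_mul (σ : I ≃ I') (e : Bool) (i j : I) (x : R I) :
    relabel σ (gen e i j * x) = gen e (σ i) (σ j) * relabel σ x := by
  rw [map_mul, relabel_gen]

theorem relabel_mem (σ : I ≃ I') {n : ℤ × ℤ} {x : R I} (hx : x ∈ (R I).gr n) :
    relabel σ x ∈ (R I').gr n := by
  refine gr_induction (P := fun n x => relabel σ x ∈ (R I').gr n) ?_ ?_ ?_ ?_ ?_ hx
  · rw [map_one]; exact SetLike.GradedOne.one_mem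
  · intro e i j n x _ hx
    rw [relabel_gen_mul]
    exact SetLike.mul_mem_graded (gen_mem _ _ _) hx
  · intro n
    rw [map_zero]; exact Submodule.zero_mem _
  · intro n x y hx hy
    rw [map_add]; exact Submodule.add_mem _ hx hy
  · intro n c x hx
    rw [map_smul]; exact Submodule.smul_mem _ _ hx

theorem relabel_diff (σ : I ≃ I') (k : Bool) (x : R I) :
    relabel σ (diff I k x) = diff I' k (relabel σ x) := by
  have : (relabel σ).toLinearMap ∘ₗ diff I k = diff I' k ∘ₗ (relabel σ).toLinearMap := by
    refine linear_ext ?_ fun e i j x hx => ?_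
    · change relabel σ (diff I k 1) = diff I' k (relabel σ 1)
      rw [map_one (relabel σ), diff_one, diff_one, map_zero]
    · replace hx : relabel σ (diff I k x) = diff I' k (relabel σ x) := hx
      change relabel σ (diff I k (gen e i j * x)) = diff I' k (relabel σ (gen e i j * x))
      rw [relabel_gen_mul, diff_gen_mul, diff_gen_mul, map_add, map_smul, relabel_gen_mul, hx,
        map_mul]
      split_ifs
      · rw [relabel_gen]
      · rw [map_zero]
  exact LinearMap.congr_fun this x

theorem relabel_twist (σ : I ≃ I') (e : Bool) (x : R I) :
    relabel σ ((R I).twist e x) = (R I').twist e (relabel σ x) := by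
  cases e
  · rfl
  have : (relabel σ).toLinearMap ∘ₗ (R I).koszulSign =
      (R I').koszulSign ∘ₗ (relabel σ).toLinearMap := by
    refine linear_ext ?_ fun e i j x hx => ?_
    · change relabel σ ((R I).koszulSign 1) = (R I').koszulSign (relabel σ 1)
      rw [map_one (relabel σ), koszulSign_one, koszulSign_one, map_one]
    · replace hx : relabel σ ((R I).koszulSign x) = (R I').koszulSign (relabel σ x) := hx
      change relabel σ ((R I).koszulSign (gen e i j * x)) =
        (R I').koszulSign (relabel σ (gen e i j * x))
      rw [relabel_gen_mul, koszulSign_mul, koszulSign_mul, map_mul, hx, koszulSign_gen,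
        koszulSign_gen, map_smul, relabel_gen]
  exact LinearMap.congr_fun this x

theorem relabel_refl (I : Type u) [Finite I] :
    relabel (Equiv.refl I) = AlgHom.id ℂ (R I) :=
  algHom_ext fun e i j _ => relabel_gen _ e i j

theorem relabel_trans (σ : I ≃ I') (ρ : I' ≃ I'') :
    relabel (σ.trans ρ) = (relabel ρ).comp (relabel σ) :=
  algHom_ext fun e i j _ => by
    rw [relabel_gen, AlgHom.comp_apply, relabel_gen, relabel_gen]
    rfl

/-! ### The cocomposition -/

section Cocomp

theorem tmul_one_mul_one_tmul' (c : R I) (c' : R J) :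
    (GradedTensorProduct.tmul ℂ c (1 : R J) : (R I).Tensor (R J)) *
      GradedTensorProduct.tmul ℂ (1 : R I) c' = GradedTensorProduct.tmul ℂ c c' :=
  GradedTensorProduct.tmul_one_mul_one_tmul (R I).gr (R J).gr c c'

/-- Graded commutativity of the generators of the two factors of a tensor product. -/
theorem one_tmul_mul_tmul_one (e e' : Bool) (i i' : I) (j j' : J) :
    (GradedTensorProduct.tmul ℂ (1 : R I) (gen e' j j') : (R I).Tensor (R J)) *
        GradedTensorProduct.tmul ℂ (gen e i i') (1 : R J) =
      (if e && e' then (-1 : ℂ) else 1) •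
        GradedTensorProduct.tmul ℂ (gen e i i') (gen e' j j') := by
  refine (unTensor_one_tmul_mul (gen_mem e' j j')
    (GradedTensorProduct.tmul ℂ (gen e i i') (1 : R J))).trans ?_
  change (R I).twist e' (gen e i i') ⊗ₜ[ℂ] (gen e' j j' * 1) =
    (if e && e' then (-1 : ℂ) else 1) • (gen e i i' ⊗ₜ[ℂ] gen e' j j')
  rw [mul_one]
  cases e'
  · rw [Bool.and_false]
    exact (one_smul ℂ _).symm
  · rw [twist_true, koszulSign_gen, ← TensorProduct.smul_tmul', Bool.and_true]
    rfl

/-- The prescribed images of the generators under the cocomposition satisfy the relations. -/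
theorem cocomp_relations (I J : Type u) [Finite I] [Finite J] :
    Relations (T := (R (Option I)).Tensor (R J))
      (glue (fun x y => GradedTensorProduct.tmul ℂ (a x y) (1 : R J))
        (fun j k => GradedTensorProduct.tmul ℂ (1 : R (Option I)) (a j k)))
      (glue (fun x y => GradedTensorProduct.tmul ℂ (b x y) (1 : R J))
        (fun j k => GradedTensorProduct.tmul ℂ (1 : R (Option I)) (b j k))) := by
  refine Relations.glued
    ((relations (Option I)).map (GradedTensorProduct.includeLeft (R (Option I)).gr (R J).gr))
    ((relations J).map (GradedTensorProduct.includeRight (R (Option I)).gr (R J).gr))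
    ?_ ?_ ?_ ?_
  · intro x y j k
    exact (tmul_one_mul_one_tmul' _ _).trans
      ((one_tmul_mul_tmul_one false false x y j k).trans (one_smul ℂ _)).symm
  · intro x y j k
    exact (tmul_one_mul_one_tmul' _ _).trans
      ((one_tmul_mul_tmul_one false true x y j k).trans (one_smul ℂ _)).symm
  · intro x y j k
    exact (tmul_one_mul_one_tmul' _ _).trans
      ((one_tmul_mul_tmul_one true false x y j k).trans (one_smul ℂ _)).symm
  · intro x y j k
    refine (tmul_one_mul_one_tmul' _ _).trans ?_
    refine Eq.trans ?_ (congrArg Neg.neg (one_tmul_mul_tmul_one true true x y j k)).symm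
    exact (neg_eq_iff_eq_neg.mpr (neg_one_smul ℂ _)).symm

/-- The cocomposition `R (I ⊔ J) → R (I ⊔ {⋆}) ⊗ R J`. -/
def cocomp (I J : Type u) [Finite I] [Finite J] :
    R (I ⊕ J) →ₐ[ℂ] (R (Option I)).Tensor (R J) :=
  (cocomp_relations I J).lift

/-- The images of the generators under the cocomposition. -/
theorem cocomp_gen (e : Bool) (x y : I ⊕ J) :
    cocomp I J (gen e x y) =
      glue (fun x y => GradedTensorProduct.tmul ℂ (gen e x y) (1 : R J))
        (fun j k => GradedTensorProduct.tmul ℂ (1 : R (Option I)) (gen e j k)) x y := by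
  cases e
  · exact (Relations.lift_mk _ (fa x y)).trans (freeLift_fa _ _ x y)
  · exact (Relations.lift_mk _ (fb x y)).trans (freeLift_fb _ _ x y)

/-- The cocomposition as a linear map to the ordinary tensor product. -/
def cocompLin (I J : Type u) [Finite I] [Finite J] :
    R (I ⊕ J) →ₗ[ℂ] R (Option I) ⊗[ℂ] R J :=
  unTensor _ _ ∘ₗ (cocomp I J).toLinearMap

/-- Left multiplication on the tensor product with the image under the cocomposition of a
generator. -/
def opCocomp (I J : Type u) [Finite I] [Finite J] (e : Bool) :
    I ⊕ J → I ⊕ J → (R (Option I) ⊗[ℂ] R J →ₗ[ℂ] R (Option I) ⊗[ℂ] R J) :=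
  glue (fun x y => opL (R (Option I)) (R J) (gen e x y))
    (fun j k => opR (R (Option I)) (R J) e (gen e j k))

theorem cocompLin_one : cocompLin I J 1 = 1 ⊗ₜ[ℂ] 1 := by
  change unTensor _ _ (cocomp I J 1) = _
  rw [map_one]
  rfl

theorem cocompLin_gen_mul (e : Bool) (x y : I ⊕ J) (z : R (I ⊕ J)) :
    cocompLin I J (gen e x y * z) = opCocomp I J e x y (cocompLin I J z) := by
  change unTensor _ _ (cocomp I J (gen e x y * z)) = _
  rw [map_mul, cocomp_gen]
  rcases x with i | j <;> rcases y with k | l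
  · exact unTensor_tmul_one_mul _ _
  · exact unTensor_tmul_one_mul _ _
  · exact unTensor_tmul_one_mul _ _
  · exact unTensor_one_tmul_mul (gen_mem e j l) _

theorem cocompLin_mem {n : ℤ × ℤ} {x : R (I ⊕ J)} (hx : x ∈ (R (I ⊕ J)).gr n) :
    cocompLin I J x ∈ tensorGr (R (Option I)) (R J) n := by
  refine gr_induction (P := fun n x => cocompLin I J x ∈ tensorGr (R (Option I)) (R J) n)
    ?_ ?_ ?_ ?_ ?_ hx
  · rw [cocompLin_one]
    exact Submodule.subset_span ⟨0, 0, 1, 1, SetLike.GradedOne.one_mem,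
      SetLike.GradedOne.one_mem, add_zero _, rfl⟩
  · intro e x y n z _ hz
    rw [cocompLin_gen_mul]
    rcases x with i | j <;> rcases y with k | l
    · exact opL_mem (gen_mem _ _ _) hz
    · exact opL_mem (gen_mem _ _ _) hz
    · exact opL_mem (gen_mem _ _ _) hz
    · exact opR_mem (gen_mem _ _ _) hz
  · intro n
    rw [map_zero]; exact Submodule.zero_mem _
  · intro n x y hx hy
    rw [map_add]; exact Submodule.add_mem _ hx hy
  · intro n c x hx
    rw [map_smul]; exact Submodule.smul_mem _ _ hx

theorem opL_zero (A B : BigradedAlg.{u}) : opL A B 0 = 0 := by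
  rw [opL, LinearMap.mulLeft_zero_eq_zero, TensorProduct.map_zero_left]

theorem opR_zero (A B : BigradedAlg.{u}) (e : Bool) : opR A B e 0 = 0 := by
  rw [opR, LinearMap.mulLeft_zero_eq_zero, TensorProduct.map_zero_right]

theorem tensorD_opCocomp (k e : Bool) (x y : I ⊕ J) (t : R (Option I) ⊗[ℂ] R J) :
    tensorD _ _ (diff (Option I) k) (diff J k) (opCocomp I J e x y t) =
      (if e = k then opCocomp I J (!e) x y t else 0) +
        paritySign e • opCocomp I J e x y (tensorD _ _ (diff (Option I) k) (diff J k) t) := by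
  have hL : ∀ p q : Option I,
      tensorD _ _ (diff (Option I) k) (diff J k) (opL (R (Option I)) (R J) (gen e p q) t) =
      (if e = k then opL (R (Option I)) (R J) (gen (!e) p q) t else 0) +
        paritySign e • opL (R (Option I)) (R J) (gen e p q)
          (tensorD _ _ (diff (Option I) k) (diff J k) t) := by
    intro p q
    rw [tensorD_opL (koszulSign_gen e p q)
      (fun x => by rw [diff_mul, koszulSign_gen, smul_mul_assoc]), diff_gen]
    split_ifs
    · rfl
    · rw [opL_zero]; rfl
  have hR : ∀ p q : J,
      tensorD _ _ (diff (Option I) k) (diff J k) (opR (R (Option I)) (R J) e (gen e p q) t) =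
      (if e = k then opR (R (Option I)) (R J) (!e) (gen (!e) p q) t else 0) +
        paritySign e • opR (R (Option I)) (R J) e (gen e p q)
          (tensorD _ _ (diff (Option I) k) (diff J k) t) := by
    intro p q
    rw [tensorD_opR (diff_koszulSign k)
      (fun x => by rw [diff_mul, koszulSign_gen, smul_mul_assoc]), diff_gen]
    split_ifs
    · rfl
    · rw [opR_zero]; rfl
  rcases x with i | j <;> rcases y with k | l
  · exact hL _ _
  · exact hL _ _
  · exact hL _ _
  · exact hR _ _

theorem cocompLin_diff (k : Bool) (x : R (I ⊕ J)) :
    cocompLin I J (diff (I ⊕ J) k x) =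
      tensorD _ _ (diff (Option I) k) (diff J k) (cocompLin I J x) := by
  have : cocompLin I J ∘ₗ diff (I ⊕ J) k =
      tensorD _ _ (diff (Option I) k) (diff J k) ∘ₗ cocompLin I J := by
    refine linear_ext (V := R (Option I) ⊗[ℂ] R J) ?_ fun e x y z hz => ?_
    · rw [LinearMap.comp_apply, LinearMap.comp_apply, diff_one, map_zero, cocompLin_one]
      change 0 = diff (Option I) k 1 ⊗ₜ[ℂ] (1 : R J) +
        (R (Option I)).koszulSign 1 ⊗ₜ[ℂ] diff J k 1
      rw [diff_one, diff_one, TensorProduct.zero_tmul, TensorProduct.tmul_zero, add_zero]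
    · rw [LinearMap.comp_apply, LinearMap.comp_apply] at hz ⊢
      rw [diff_gen_mul, map_add, map_smul, cocompLin_gen_mul, cocompLin_gen_mul, tensorD_opCocomp,
        hz]
      split_ifs
      · rw [cocompLin_gen_mul]
      · rw [zero_mul, map_zero]
  exact LinearMap.congr_fun this x

theorem cocompLin_twist (e : Bool) (x : R (I ⊕ J)) :
    cocompLin I J ((R (I ⊕ J)).twist e x) =
      TensorProduct.map ((R (Option I)).twist e) ((R J).twist e) (cocompLin I J x) := by
  cases e
  · rw [twist_false, twist_false, twist_false, TensorProduct.map_id]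
    rfl
  have hg : ∀ e' (x y : I ⊕ J) (t : R (Option I) ⊗[ℂ] R J),
      TensorProduct.map (R (Option I)).koszulSign (R J).koszulSign (opCocomp I J e' x y t) =
        paritySign e' • opCocomp I J e' x y
          (TensorProduct.map (R (Option I)).koszulSign (R J).koszulSign t) := by
    intro e' x y t
    rcases x with i | j <;> rcases y with k | l
    · exact map_koszulSign_opL (koszulSign_gen _ _ _) t
    · exact map_koszulSign_opL (koszulSign_gen _ _ _) t
    · exact map_koszulSign_opL (koszulSign_gen _ _ _) t
    · exact map_koszulSign_opR (koszulSign_gen _ _ _) t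
  have : cocompLin I J ∘ₗ (R (I ⊕ J)).koszulSign =
      TensorProduct.map (R (Option I)).koszulSign (R J).koszulSign ∘ₗ cocompLin I J := by
    refine linear_ext (V := R (Option I) ⊗[ℂ] R J) ?_ fun e x y z hz => ?_
    · rw [LinearMap.comp_apply, LinearMap.comp_apply, koszulSign_one, cocompLin_one,
        TensorProduct.map_tmul, koszulSign_one, koszulSign_one]
    · rw [LinearMap.comp_apply, LinearMap.comp_apply] at hz ⊢
      rw [koszulSign_mul, koszulSign_gen, smul_mul_assoc, map_smul, cocompLin_gen_mul,
        cocompLin_gen_mul, hz, hg]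
  exact LinearMap.congr_fun this x

theorem cocompLin_natural (σ : I ≃ I') (ρ : J ≃ J') :
    cocompLin I' J' ∘ₗ (relabel (Equiv.sumCongr σ ρ)).toLinearMap =
      TensorProduct.map (relabel (Equiv.optionCongr σ)).toLinearMap (relabel ρ).toLinearMap ∘ₗ
        cocompLin I J := by
  refine linear_ext (V := R (Option I') ⊗[ℂ] R J') ?_ fun e x y z hz => ?_
  · change cocompLin I' J' (relabel _ 1) = TensorProduct.map _ _ (cocompLin I J 1)
    rw [map_one, cocompLin_one, cocompLin_one, TensorProduct.map_tmul]
    change 1 ⊗ₜ[ℂ] 1 = relabel _ 1 ⊗ₜ[ℂ] relabel _ 1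
    rw [map_one, map_one]
  · rw [LinearMap.comp_apply, LinearMap.comp_apply, AlgHom.toLinearMap_apply] at hz ⊢
    rw [relabel_gen_mul, cocompLin_gen_mul, cocompLin_gen_mul, hz]
    have hL : ∀ (p q : Option I) (t : R (Option I) ⊗[ℂ] R J),
        opL (R (Option I')) (R J') (gen e (Equiv.optionCongr σ p) (Equiv.optionCongr σ q))
          (TensorProduct.map (relabel (Equiv.optionCongr σ)).toLinearMap
            (relabel ρ).toLinearMap t) =
        TensorProduct.map (relabel (Equiv.optionCongr σ)).toLinearMap (relabel ρ).toLinearMap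
          (opL (R (Option I)) (R J) (gen e p q) t) := fun p q t =>
      (map_opL _ _ _ _ (relabel_gen_mul (Equiv.optionCongr σ) e p q) t).symm
    rcases x with i | j <;> rcases y with k | l
    · exact hL (some i) (some k) _
    · exact hL (some i) none _
    · exact hL none (some k) _
    · exact (map_opR _ _ _ _ e _ (relabel_twist (Equiv.optionCongr σ) e)
        (relabel_gen_mul ρ e j l) _).symm

end Cocomp

end R

namespace BigradedAlg

/-! ### Multiplication in triple tensor products -/

variable {A B C : BigradedAlg.{u}}

/-- Left multiplication by `c ⊗ 1 ⊗ 1` on `A ⊗ (B ⊗ C)`. -/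
def op₁ (A B C : BigradedAlg.{u}) (c : A) : A ⊗[ℂ] (B ⊗[ℂ] C) →ₗ[ℂ] A ⊗[ℂ] (B ⊗[ℂ] C) :=
  TensorProduct.map (LinearMap.mulLeft ℂ c) LinearMap.id

/-- Left multiplication by `1 ⊗ c ⊗ 1` on `A ⊗ (B ⊗ C)`, for `c` of parity `e`. -/
def op₂ (A B C : BigradedAlg.{u}) (e : Bool) (c : B) :
    A ⊗[ℂ] (B ⊗[ℂ] C) →ₗ[ℂ] A ⊗[ℂ] (B ⊗[ℂ] C) :=
  TensorProduct.map (A.twist e) (opL B C c)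

/-- Left multiplication by `1 ⊗ 1 ⊗ c` on `A ⊗ (B ⊗ C)`, for `c` of parity `e`. -/
def op₃ (A B C : BigradedAlg.{u}) (e : Bool) (c : C) :
    A ⊗[ℂ] (B ⊗[ℂ] C) →ₗ[ℂ] A ⊗[ℂ] (B ⊗[ℂ] C) :=
  TensorProduct.map (A.twist e) (opR B C e c)

theorem assoc_opL (c : A) (t : (A ⊗[ℂ] B) ⊗[ℂ] C) :
    TensorProduct.assoc ℂ A B C (TensorProduct.map (opL A B c) LinearMap.id t) =
      op₁ A B C c (TensorProduct.assoc ℂ A B C t) := by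
  rw [op₁, opL, ← TensorProduct.map_map_assoc, TensorProduct.map_id]

theorem assoc_opR (e : Bool) (c : B) (t : (A ⊗[ℂ] B) ⊗[ℂ] C) :
    TensorProduct.assoc ℂ A B C (TensorProduct.map (opR A B e c) LinearMap.id t) =
      op₂ A B C e c (TensorProduct.assoc ℂ A B C t) := by
  rw [op₂, opR, ← TensorProduct.map_map_assoc]
  rfl

theorem assoc_twist (e : Bool) (c : C) (t : (A ⊗[ℂ] B) ⊗[ℂ] C) :
    TensorProduct.assoc ℂ A B C (TensorProduct.map (TensorProduct.map (A.twist e) (B.twist e))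
      (LinearMap.mulLeft ℂ c) t) = op₃ A B C e c (TensorProduct.assoc ℂ A B C t) := by
  rw [op₃, opR, ← TensorProduct.map_map_assoc]

variable {A' : BigradedAlg.{u}}

theorem map_op₁ (F : A →ₐ[ℂ] A') (G : B ⊗[ℂ] C →ₗ[ℂ] C ⊗[ℂ] B) (c : A)
    (t : A ⊗[ℂ] (B ⊗[ℂ] C)) :
    TensorProduct.map F.toLinearMap G (op₁ A B C c t) =
      op₁ A' C B (F c) (TensorProduct.map F.toLinearMap G t) := by
  induction t using TensorProduct.induction_on with
  | zero => simp
  | add t t' ht ht' => simp only [map_add, ht, ht']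
  | tmul x y =>
    simp only [op₁, TensorProduct.map_tmul, LinearMap.mulLeft_apply, AlgHom.toLinearMap_apply,
      map_mul, LinearMap.id_apply]

theorem map_tau_op₂ (F : A →ₐ[ℂ] A') {e : Bool} {q : ℤ}
    (hF : ∀ x, F (A.twist e x) = A'.twist e (F x)) {c : B} (hc : c ∈ B.gr (parityDeg e, q))
    (t : A ⊗[ℂ] (B ⊗[ℂ] C)) :
    TensorProduct.map F.toLinearMap (tau B C) (op₂ A B C e c t) =
      op₃ A' C B e c (TensorProduct.map F.toLinearMap (tau B C) t) := by
  induction t using TensorProduct.induction_on with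
  | zero => simp
  | add t t' ht ht' => simp only [map_add, ht, ht']
  | tmul x y =>
    simp only [op₂, op₃, TensorProduct.map_tmul, AlgHom.toLinearMap_apply, hF, tau_opL hc]

theorem map_tau_op₃ (F : A →ₐ[ℂ] A') {e : Bool} {q : ℤ}
    (hF : ∀ x, F (A.twist e x) = A'.twist e (F x)) {c : C} (hc : c ∈ C.gr (parityDeg e, q))
    (t : A ⊗[ℂ] (B ⊗[ℂ] C)) :
    TensorProduct.map F.toLinearMap (tau B C) (op₃ A B C e c t) =
      op₂ A' C B e c (TensorProduct.map F.toLinearMap (tau B C) t) := by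
  induction t using TensorProduct.induction_on with
  | zero => simp
  | add t t' ht ht' => simp only [map_add, ht, ht']
  | tmul x y =>
    simp only [op₂, op₃, TensorProduct.map_tmul, AlgHom.toLinearMap_apply, hF, tau_opR hc]

end BigradedAlg

namespace R

open BigradedAlg RAlg

/-! ### Coassociativity -/

variable (I J K : Type u) [Finite I] [Finite J] [Finite K]

/-- A cocomposition after a bijection. -/
def relabelCocomp {L : Type u} [Finite L] (σ : L ≃ I ⊕ J) :
    R L →ₗ[ℂ] R (Option I) ⊗[ℂ] R J :=
  cocompLin I J ∘ₗ (relabel σ).toLinearMap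

variable {I J K} in
theorem relabelCocomp_one {L : Type u} [Finite L] (σ : L ≃ I ⊕ J) :
    relabelCocomp I J σ 1 = 1 ⊗ₜ[ℂ] 1 := by
  change cocompLin I J (relabel σ 1) = _
  rw [map_one, cocompLin_one]

variable {I J K} in
theorem relabelCocomp_gen_mul {L : Type u} [Finite L] (σ : L ≃ I ⊕ J) (e : Bool) (x y : L)
    (z : R L) :
    relabelCocomp I J σ (gen e x y * z) =
      opCocomp I J e (σ x) (σ y) (relabelCocomp I J σ z) := by
  change cocompLin I J (relabel σ (gen e x y * z)) = _
  rw [relabel_gen_mul, cocompLin_gen_mul]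
  rfl

variable {I J K} in
theorem relabelCocomp_twist {L : Type u} [Finite L] (σ : L ≃ I ⊕ J) (e : Bool) (z : R L) :
    relabelCocomp I J σ ((R L).twist e z) =
      TensorProduct.map ((R (Option I)).twist e) ((R J).twist e) (relabelCocomp I J σ z) := by
  change cocompLin I J (relabel σ ((R L).twist e z)) = _
  rw [relabel_twist, cocompLin_twist]
  rfl

/-- A cocomposition, followed by a second cocomposition of the first factor. -/
def cocompLeft {L M N : Type u} [Finite L] [Finite M] [Finite N] (σ : Option L ≃ M ⊕ N) :
    R (L ⊕ K) →ₗ[ℂ] R (Option M) ⊗[ℂ] (R N ⊗[ℂ] R K) :=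
  (TensorProduct.assoc ℂ (R (Option M)) (R N) (R K)).toLinearMap ∘ₗ
    TensorProduct.map (relabelCocomp M N σ) LinearMap.id ∘ₗ cocompLin L K

section CocompLeft

variable {K} {L M N : Type u} [Finite L] [Finite M] [Finite N] (σ : Option L ≃ M ⊕ N)

theorem cocompLeft_apply (z : R (L ⊕ K)) :
    cocompLeft K σ z = TensorProduct.assoc ℂ (R (Option M)) (R N) (R K)
      (TensorProduct.map (relabelCocomp M N σ) LinearMap.id (cocompLin L K z)) := rfl

theorem cocompLeft_one : cocompLeft K σ 1 = 1 ⊗ₜ[ℂ] (1 ⊗ₜ[ℂ] 1) := by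
  rw [cocompLeft, LinearMap.comp_apply, LinearMap.comp_apply, cocompLin_one,
    TensorProduct.map_tmul, relabelCocomp_one]
  rfl

/-- Generators with both indices in `K` act on the third factor. -/
theorem cocompLeft_inr (e : Bool) (k k' : K) (z : R (L ⊕ K)) :
    cocompLeft K σ (gen e (Sum.inr k) (Sum.inr k') * z) =
      op₃ _ _ _ e (gen e k k') (cocompLeft K σ z) := by
  have hop : opCocomp L K e (Sum.inr k) (Sum.inr k') =
      opR (R (Option L)) (R K) e (gen e k k') := rfl
  rw [cocompLeft_apply σ (_ * z), cocompLin_gen_mul, hop,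
    map_opR (relabelCocomp M N σ) LinearMap.id _ (LinearMap.mulLeft ℂ (gen e k k')) e
      (gen e k k') (relabelCocomp_twist σ e) (fun _ => rfl) (cocompLin L K z),
    assoc_twist, ← cocompLeft_apply]

/-- The other generators act through the second cocomposition. -/
theorem cocompLeft_of_ne (e : Bool) (x y : L ⊕ K) (p q : M ⊕ N)
    (hxy : opCocomp L K e x y = opL _ _ (gen e (collapse x) (collapse y)))
    (hp : σ (collapse x) = p) (hq : σ (collapse y) = q) (z : R (L ⊕ K)) :
    cocompLeft K σ (gen e x y * z) =
      TensorProduct.assoc ℂ (R (Option M)) (R N) (R K)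
        (TensorProduct.map (opCocomp M N e p q) LinearMap.id
          (TensorProduct.map (relabelCocomp M N σ) LinearMap.id (cocompLin L K z))) := by
  subst hp hq
  rw [cocompLeft_apply σ (_ * z), cocompLin_gen_mul, hxy,
    map_opL (relabelCocomp M N σ) LinearMap.id _ _
      (relabelCocomp_gen_mul σ e (collapse x) (collapse y)) (cocompLin L K z)]

theorem cocompLeft_op₁ (e : Bool) (x y : L ⊕ K) (p q : M ⊕ N)
    (hxy : opCocomp L K e x y = opL _ _ (gen e (collapse x) (collapse y)))
    (hp : σ (collapse x) = p) (hq : σ (collapse y) = q)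
    (hpq : opCocomp M N e p q = opL _ _ (gen e (collapse p) (collapse q))) (z : R (L ⊕ K)) :
    cocompLeft K σ (gen e x y * z) =
      op₁ _ _ _ (gen e (collapse p) (collapse q)) (cocompLeft K σ z) := by
  rw [cocompLeft_of_ne σ e x y p q hxy hp hq, hpq]
  exact assoc_opL _ _

theorem cocompLeft_op₂ (e : Bool) (x y : L ⊕ K) (n n' : N)
    (hxy : opCocomp L K e x y = opL _ _ (gen e (collapse x) (collapse y)))
    (hp : σ (collapse x) = Sum.inr n) (hq : σ (collapse y) = Sum.inr n') (z : R (L ⊕ K)) :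
    cocompLeft K σ (gen e x y * z) = op₂ _ _ _ e (gen e n n') (cocompLeft K σ z) := by
  rw [cocompLeft_of_ne σ e x y _ _ hxy hp hq]
  exact assoc_opR _ _ _

end CocompLeft

/-- Sequential coassociativity: both sides turn left multiplication with a generator into the
same operator on the triple tensor product. -/
theorem coassoc_seq :
    cocompLeft K (optionSumRight I J) =
      TensorProduct.map LinearMap.id (cocompLin J K) ∘ₗ
        relabelCocomp I (J ⊕ K) (Equiv.sumAssoc I J K) := by
  have hL : ∀ (c : R (Option I)) (t : R (Option I) ⊗[ℂ] R (J ⊕ K)),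
      TensorProduct.map LinearMap.id (cocompLin J K) (opL _ _ c t) =
        op₁ (R (Option I)) (R (Option J)) (R K) c
          (TensorProduct.map LinearMap.id (cocompLin J K) t) :=
    fun c t => by
      rw [op₁]
      exact map_opL LinearMap.id (cocompLin J K) (LinearMap.mulLeft ℂ c) c (fun _ => rfl) t
  have hR : ∀ (e : Bool) (p q : J ⊕ K) (t : R (Option I) ⊗[ℂ] R (J ⊕ K)),
      TensorProduct.map LinearMap.id (cocompLin J K) (opR _ _ e (gen e p q) t) =
        TensorProduct.map ((R (Option I)).twist e) (opCocomp J K e p q)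
          (TensorProduct.map LinearMap.id (cocompLin J K) t) :=
    fun e p q t => map_opR LinearMap.id _ _ _ e _ (fun _ => rfl) (cocompLin_gen_mul e p q) t
  refine linear_ext (V := R (Option I) ⊗[ℂ] (R (Option J) ⊗[ℂ] R K)) ?_ fun e x y z hz => ?_
  · rw [cocompLeft_one, LinearMap.comp_apply, relabelCocomp_one, TensorProduct.map_tmul,
      cocompLin_one]
    rfl
  · rw [LinearMap.comp_apply] at hz ⊢
    rw [relabelCocomp_gen_mul]
    rcases x with (i | j) | k <;> rcases y with (i' | j') | k'
    · rw [cocompLeft_op₁ _ e _ _ (Sum.inl i) (Sum.inl i') rfl rfl rfl rfl, hz]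
      exact (hL _ _).symm
    · rw [cocompLeft_op₁ _ e _ _ (Sum.inl i) (Sum.inr (some j')) rfl rfl rfl rfl, hz]
      exact (hL _ _).symm
    · rw [cocompLeft_op₁ _ e _ _ (Sum.inl i) (Sum.inr none) rfl rfl rfl rfl, hz]
      exact (hL _ _).symm
    · rw [cocompLeft_op₁ _ e _ _ (Sum.inr (some j)) (Sum.inl i') rfl rfl rfl rfl, hz]
      exact (hL _ _).symm
    · rw [cocompLeft_op₂ _ e _ _ (some j) (some j') rfl rfl rfl, hz]
      exact (hR e (Sum.inl j) (Sum.inl j') _).symm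
    · rw [cocompLeft_op₂ _ e _ _ (some j) none rfl rfl rfl, hz]
      exact (hR e (Sum.inl j) (Sum.inr k') _).symm
    · rw [cocompLeft_op₁ _ e _ _ (Sum.inr none) (Sum.inl i') rfl rfl rfl rfl, hz]
      exact (hL _ _).symm
    · rw [cocompLeft_op₂ _ e _ _ none (some j') rfl rfl rfl, hz]
      exact (hR e (Sum.inr k) (Sum.inl j') _).symm
    · rw [cocompLeft_inr, hz]
      exact (hR e (Sum.inr k) (Sum.inr k') _).symm

/-- Parallel coassociativity; the symmetry exchanges the operators on the last two factors. -/
theorem coassoc_par :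
    cocompLeft K (optionSumLeft I J) =
      TensorProduct.map (relabel (optionSwap I)).toLinearMap (tau (R K) (R J)) ∘ₗ
        cocompLeft J (optionSumLeft I K) ∘ₗ (relabel (sumRightComm I J K)).toLinearMap := by
  have h1 := map_op₁ (relabel (optionSwap I)) (tau (R K) (R J))
  refine linear_ext (V := R (Option (Option I)) ⊗[ℂ] (R J ⊗[ℂ] R K)) ?_ fun e x y z hz => ?_
  · rw [cocompLeft_one, LinearMap.comp_apply, LinearMap.comp_apply, AlgHom.toLinearMap_apply,
      map_one, cocompLeft_one, TensorProduct.map_tmul, tau_one, AlgHom.toLinearMap_apply, map_one]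
  · have h2 := fun k k' => map_tau_op₂ (C := R J) (relabel (optionSwap I))
      (relabel_twist (optionSwap I) e) (gen_mem e (k : K) k')
    have h3 := fun j j' => map_tau_op₃ (B := R K) (relabel (optionSwap I))
      (relabel_twist (optionSwap I) e) (gen_mem e (j : J) j')
    rw [LinearMap.comp_apply, LinearMap.comp_apply, AlgHom.toLinearMap_apply] at hz ⊢
    rw [relabel_gen_mul]
    -- generators that neither have both indices in `J` nor both in `K` act on the first factor
    have hop : ∀ (p q : Option I ⊕ K) (p' q' : Option I ⊕ J)
        (hpq : opCocomp (Option I) K e p q = opL _ _ (gen e (collapse p) (collapse q)))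
        (hpq' : opCocomp (Option I) J e p' q' = opL _ _ (gen e (collapse p') (collapse q')))
        (hx : optionSumLeft I J (collapse x) = p')
        (hy : optionSumLeft I J (collapse y) = q')
        (hxy : opCocomp (I ⊕ J) K e x y = opL _ _ (gen e (collapse x) (collapse y)))
        (hx' : optionSumLeft I K (collapse (sumRightComm I J K x)) = p)
        (hy' : optionSumLeft I K (collapse (sumRightComm I J K y)) = q)
        (hxy' : opCocomp (I ⊕ K) J e (sumRightComm I J K x) (sumRightComm I J K y) =
          opL _ _ (gen e (collapse (sumRightComm I J K x)) (collapse (sumRightComm I J K y))))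
        (hp : optionSwap I (collapse p) = collapse p')
        (hq : optionSwap I (collapse q) = collapse q'),
        cocompLeft K (optionSumLeft I J) (gen e x y * z) =
          TensorProduct.map (relabel (optionSwap I)).toLinearMap (tau (R K) (R J))
            (cocompLeft J (optionSumLeft I K)
              (gen e (sumRightComm I J K x) (sumRightComm I J K y) *
                relabel (sumRightComm I J K) z)) := by
      intro p q p' q' hpq hpq' hx hy hxy hx' hy' hxy' hp hq
      rw [cocompLeft_op₁ _ e _ _ p q hxy' hx' hy' hpq, cocompLeft_op₁ _ e _ _ p' q' hxy hx hy hpq',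
        h1, ← hz, relabel_gen, hp, hq]
    rcases x with (i | j) | k <;> rcases y with (i' | j') | k'
    · exact hop (Sum.inl (some i)) (Sum.inl (some i')) (Sum.inl (some i)) (Sum.inl (some i'))
        rfl rfl rfl rfl rfl rfl rfl rfl rfl rfl
    · exact hop (Sum.inl (some i)) (Sum.inl none) (Sum.inl (some i)) (Sum.inr j')
        rfl rfl rfl rfl rfl rfl rfl rfl rfl rfl
    · exact hop (Sum.inl (some i)) (Sum.inr k') (Sum.inl (some i)) (Sum.inl none)
        rfl rfl rfl rfl rfl rfl rfl rfl rfl rfl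
    · exact hop (Sum.inl none) (Sum.inl (some i')) (Sum.inr j) (Sum.inl (some i'))
        rfl rfl rfl rfl rfl rfl rfl rfl rfl rfl
    · rw [cocompLeft_op₂ _ e _ _ j j' rfl rfl rfl, hz]
      refine Eq.trans ?_ (congrArg _ (cocompLeft_inr _ e j j' _)).symm
      exact (h3 j j' _).symm
    · exact hop (Sum.inl none) (Sum.inr k') (Sum.inr j) (Sum.inl none)
        rfl rfl rfl rfl rfl rfl rfl rfl rfl rfl
    · exact hop (Sum.inr k) (Sum.inl (some i')) (Sum.inl none) (Sum.inl (some i'))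
        rfl rfl rfl rfl rfl rfl rfl rfl rfl rfl
    · exact hop (Sum.inr k) (Sum.inl none) (Sum.inl none) (Sum.inr j')
        rfl rfl rfl rfl rfl rfl rfl rfl rfl rfl
    · rw [cocompLeft_inr, hz]
      refine Eq.trans ?_ (congrArg _ (cocompLeft_op₂ _ e (Sum.inl (Sum.inr k))
        (Sum.inl (Sum.inr k')) k k' rfl rfl rfl _)).symm
      exact (h2 k k' _).symm

end R

namespace R

open BigradedAlg RAlg

/-! ### The counit -/

section Counit

variable {I : Type u} [Finite I]

/-- The augmentation `R I → ℂ` that kills the generators. -/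
def augmentation (I : Type u) [Finite I] : R I →ₐ[ℂ] ℂ :=
  (Relations.zero (I := I) (T := ℂ)).lift

theorem augmentation_gen (e : Bool) (i j : I) : augmentation I (gen e i j) = 0 := by
  cases e
  · exact (Relations.lift_mk _ (fa i j)).trans (freeLift_fa _ _ i j)
  · exact (Relations.lift_mk _ (fb i j)).trans (freeLift_fb _ _ i j)

theorem augmentation_gen_mul (e : Bool) (i j : I) (x : R I) :
    augmentation I (gen e i j * x) = 0 := by
  rw [map_mul, augmentation_gen, zero_mul]

theorem augmentation_eq_zero {n : ℤ × ℤ} {x : R I} (hx : x ∈ (R I).gr n) (hn : n ≠ 0) :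
    augmentation I x = 0 := by
  refine gr_induction (P := fun n x => n ≠ 0 → augmentation I x = 0) ?_ ?_ ?_ ?_ ?_ hx hn
  · exact fun h => absurd rfl h
  · exact fun e i j n x _ _ _ => augmentation_gen_mul e i j x
  · exact fun _ _ => map_zero _
  · intro n x y hx hy h
    rw [map_add, hx h, hy h, add_zero]
  · intro n c x hx h
    rw [map_smul, hx h, smul_zero]

theorem augmentation_diff (k : Bool) (x : R I) : augmentation I (diff I k x) = 0 := by
  have : (augmentation I).toLinearMap ∘ₗ diff I k = 0 := by
    refine linear_ext ?_ fun e i j x hx => ?_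
    · rw [LinearMap.comp_apply, diff_one, map_zero, LinearMap.zero_apply]
    · rw [LinearMap.zero_apply, LinearMap.comp_apply, diff_gen_mul, map_add, map_smul,
        AlgHom.toLinearMap_apply, AlgHom.toLinearMap_apply, augmentation_gen_mul, smul_zero,
        add_zero]
      split_ifs
      · exact augmentation_gen_mul _ _ _ _
      · rw [zero_mul, map_zero]
  exact LinearMap.congr_fun this x

theorem augmentation_twist (e : Bool) (x : R I) :
    augmentation I ((R I).twist e x) = augmentation I x := by
  cases e
  · rfl
  have : (augmentation I).toLinearMap ∘ₗ (R I).koszulSign = (augmentation I).toLinearMap := by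
    refine linear_ext ?_ fun e i j x _ => ?_
    · rw [LinearMap.comp_apply, koszulSign_one]
    · rw [LinearMap.comp_apply, AlgHom.toLinearMap_apply, AlgHom.toLinearMap_apply, koszulSign_mul,
        koszulSign_gen, smul_mul_assoc, map_smul, augmentation_gen_mul, augmentation_gen_mul,
        smul_zero]
  exact LinearMap.congr_fun this x

theorem lid_map_mulLeft {A : BigradedAlg.{u}} (c : A) (t : ℂ ⊗[ℂ] A) :
    TensorProduct.lid ℂ A (TensorProduct.map LinearMap.id (LinearMap.mulLeft ℂ c) t) =
      c * TensorProduct.lid ℂ A t := by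
  induction t using TensorProduct.induction_on with
  | zero => simp
  | add t t' ht ht' => simp only [map_add, ht, ht', mul_add]
  | tmul x y => simp

theorem rid_map_mulLeft {A : BigradedAlg.{u}} (c : A) (t : A ⊗[ℂ] ℂ) :
    TensorProduct.rid ℂ A (TensorProduct.map (LinearMap.mulLeft ℂ c) LinearMap.id t) =
      c * TensorProduct.rid ℂ A t := by
  induction t using TensorProduct.induction_on with
  | zero => simp
  | add t t' ht ht' => simp only [map_add, ht, ht', mul_add]
  | tmul x y => simp

theorem counit_left (J : Type u) [Finite J] (φ : Option PEmpty.{u + 1} ≃ PUnit.{u + 1}) :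
    (TensorProduct.lid ℂ (R J)).toLinearMap ∘ₗ
        TensorProduct.map ((augmentation PUnit.{u + 1}).toLinearMap ∘ₗ (relabel φ).toLinearMap)
          LinearMap.id ∘ₗ cocompLin PEmpty.{u + 1} J =
      (relabel (Equiv.emptySum PEmpty.{u + 1} J)).toLinearMap := by
  refine linear_ext ?_ fun e x y z hz => ?_
  · rw [LinearMap.comp_apply, LinearMap.comp_apply, cocompLin_one, TensorProduct.map_tmul]
    change TensorProduct.lid ℂ (R J) (augmentation _ (relabel φ 1) ⊗ₜ[ℂ] (1 : R J)) =
      relabel (Equiv.emptySum PEmpty.{u + 1} J) 1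
    rw [map_one (relabel φ), map_one (augmentation _), map_one (relabel _),
      TensorProduct.lid_tmul, one_smul]
  · rcases x with x | j
    · exact x.elim
    rcases y with y | j'
    · exact y.elim
    have hop : opCocomp PEmpty.{u + 1} J e (Sum.inr j) (Sum.inr j') =
      opR (R (Option PEmpty.{u + 1})) (R J) e (gen e j j') := rfl
    have hF : ∀ x, ((augmentation PUnit.{u + 1}).toLinearMap ∘ₗ (relabel φ).toLinearMap)
        ((R (Option PEmpty.{u + 1})).twist e x) = LinearMap.id (R := ℂ)
          (((augmentation PUnit.{u + 1}).toLinearMap ∘ₗ (relabel φ).toLinearMap) x) := by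
      intro x
      change augmentation _ (relabel φ ((R _).twist e x)) = augmentation _ (relabel φ x)
      rw [relabel_twist, augmentation_twist]
    rw [LinearMap.comp_apply, LinearMap.comp_apply, LinearEquiv.coe_coe,
      AlgHom.toLinearMap_apply] at hz ⊢
    rw [cocompLin_gen_mul, hop,
      map_opR (_ ∘ₗ _) LinearMap.id LinearMap.id (LinearMap.mulLeft ℂ (gen e j j')) e
        (gen e j j') hF (fun _ => rfl), lid_map_mulLeft, hz, relabel_gen_mul]
    rfl

theorem counit_right (I : Type u) [Finite I] :
    (TensorProduct.rid ℂ (R (Option I))).toLinearMap ∘ₗ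
        TensorProduct.map LinearMap.id (augmentation PUnit.{u + 1}).toLinearMap ∘ₗ
          cocompLin I PUnit.{u + 1} =
      (relabel (Equiv.optionEquivSumPUnit.{u} I).symm).toLinearMap := by
  have hL : ∀ (c : R (Option I)) (t : R (Option I) ⊗[ℂ] R PUnit.{u + 1}),
      TensorProduct.rid ℂ (R (Option I)) (TensorProduct.map LinearMap.id
        (augmentation PUnit.{u + 1}).toLinearMap (opL _ _ c t)) =
      c * TensorProduct.rid ℂ (R (Option I)) (TensorProduct.map LinearMap.id
        (augmentation PUnit.{u + 1}).toLinearMap t) := by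
    intro c t
    rw [map_opL LinearMap.id _ (LinearMap.mulLeft ℂ c) c (fun _ => rfl), rid_map_mulLeft]
  refine linear_ext ?_ fun e x y z hz => ?_
  · rw [LinearMap.comp_apply, LinearMap.comp_apply, cocompLin_one, TensorProduct.map_tmul]
    change TensorProduct.rid ℂ (R (Option I)) ((1 : R (Option I)) ⊗ₜ[ℂ] augmentation _ 1) =
      relabel _ 1
    rw [map_one (augmentation _), map_one (relabel _), TensorProduct.rid_tmul, one_smul]
  · by_cases hxy : x = y
    · rw [hxy, gen_self, zero_mul, map_zero, map_zero]
    rw [LinearMap.comp_apply, LinearMap.comp_apply, LinearEquiv.coe_coe,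
      AlgHom.toLinearMap_apply] at hz ⊢
    rw [cocompLin_gen_mul, relabel_gen_mul, ← hz]
    rcases x with i | ⟨⟩ <;> rcases y with i' | ⟨⟩
    · exact hL (gen e (some i) (some i')) _
    · exact hL (gen e (some i) none) _
    · exact hL (gen e none (some i')) _
    · exact absurd rfl hxy

end Counit

/-! ### The Hopf cooperad structure and its uniqueness -/

/-- The Hopf cooperad structure on the algebras `R I`. -/
def hopfCooperad : HopfCooperad.{u} (fun I _ => R I) where
  bidiff I _ := bidiff I
  map σ := relabel σ
  map_mem σ _ _ hx := relabel_mem σ hx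
  map_d σ x := relabel_diff σ false x
  map_dPrime σ x := relabel_diff σ true x
  map_refl I _ := relabel_refl I
  map_trans σ ρ := relabel_trans σ ρ
  cocomp I J _ _ := cocomp I J
  cocomp_mem _ _ _ _ _ _ hx := cocompLin_mem hx
  cocomp_d _ _ _ _ x := cocompLin_diff false x
  cocomp_dPrime _ _ _ _ x := cocompLin_diff true x
  cocomp_natural σ ρ := cocompLin_natural σ ρ
  coassoc_seq I J K _ _ _ := coassoc_seq I J K
  coassoc_par I J K _ _ _ := coassoc_par I J K
  counit := augmentation PUnit.{u + 1}
  counit_mem _ _ hx hn := augmentation_eq_zero hx hn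
  counit_d x := augmentation_diff false x
  counit_dPrime x := augmentation_diff true x
  counit_left J _ := counit_left J _
  counit_right I _ := counit_right I

section Uniqueness

variable {I : Type u} [Finite I]

/-- A linear map that satisfies the graded Leibniz rule and has the same values as a
differential of `R I` on the generators agrees with it. -/
theorem eq_diff (k : Bool) (D : R I →ₗ[ℂ] R I)
    (hD : ∀ (p q : ℤ) (x y : R I), x ∈ (R I).gr (p, q) →
      D (x * y) = D x * y + ((p.negOnePow : ℤ) : ℂ) • (x * D y))
    (hgen : ∀ e (i j : I), i ≠ j → D (gen e i j) = diff I k (gen e i j)) : D = diff I k := by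
  refine linear_ext ?_ fun e i j x hx => ?_
  · have h := hD 0 0 1 1 SetLike.GradedOne.one_mem
    rw [mul_one, mul_one, one_mul, Int.negOnePow_zero, Units.val_one, Int.cast_one, one_smul,
      left_eq_add] at h
    rw [h, diff_one]
  · by_cases hij : i = j
    · rw [hij, gen_self, zero_mul, map_zero, map_zero]
    rw [hD _ _ _ _ (gen_mem e i j), hgen e i j hij, diff_mul, hx,
      koszulSign_apply _ _ _ (gen_mem e i j), smul_mul_assoc]

end Uniqueness

end R

theorem mainTheorem7 :
    ∃! C : HopfCooperad.{u} (fun I _ => R I),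
      -- the differentials
      (∀ (I : Type u) [Finite I] (i j : I), i ≠ j →
        (C.bidiff I).d (R.a i j) = R.b i j ∧ (C.bidiff I).d (R.b i j) = 0 ∧
        (C.bidiff I).dPrime (R.b i j) = R.a i j ∧ (C.bidiff I).dPrime (R.a i j) = 0) ∧
      -- the action of bijections
      (∀ (I I' : Type u) [Finite I] [Finite I'] (σ : I ≃ I') (i j : I), i ≠ j →
        C.map σ (R.a i j) = R.a (σ i) (σ j) ∧ C.map σ (R.b i j) = R.b (σ i) (σ j)) ∧
      -- the cocomposition maps
      (∀ (I J : Type u) [Finite I] [Finite J],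
        (∀ i j : I, i ≠ j →
          C.cocomp I J (R.a (Sum.inl i) (Sum.inl j)) = R.a (some i) (some j) ᵍ⊗ₜ[ℂ] 1 ∧
          C.cocomp I J (R.b (Sum.inl i) (Sum.inl j)) = R.b (some i) (some j) ᵍ⊗ₜ[ℂ] 1) ∧
        (∀ i j : J, i ≠ j →
          C.cocomp I J (R.a (Sum.inr i) (Sum.inr j)) = 1 ᵍ⊗ₜ[ℂ] R.a i j ∧
          C.cocomp I J (R.b (Sum.inr i) (Sum.inr j)) = 1 ᵍ⊗ₜ[ℂ] R.b i j) ∧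
        (∀ (i : I) (j : J),
          C.cocomp I J (R.a (Sum.inl i) (Sum.inr j)) = R.a (some i) none ᵍ⊗ₜ[ℂ] 1 ∧
          C.cocomp I J (R.b (Sum.inl i) (Sum.inr j)) = R.b (some i) none ᵍ⊗ₜ[ℂ] 1)) := by
  refine ⟨R.hopfCooperad, ⟨?_, ?_, ?_⟩, ?_⟩
  · intro I _ i j _
    exact ⟨R.diff_gen false false i j, R.diff_gen false true i j, R.diff_gen true true i j,
      R.diff_gen true false i j⟩
  · intro I I' _ _ σ i j _
    exact ⟨R.relabel_gen σ false i j, R.relabel_gen σ true i j⟩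
  · intro I J _ _
    exact ⟨fun i j _ => ⟨R.cocomp_gen false _ _, R.cocomp_gen true _ _⟩,
      fun i j _ => ⟨R.cocomp_gen false _ _, R.cocomp_gen true _ _⟩,
      fun i j => ⟨R.cocomp_gen false _ _, R.cocomp_gen true _ _⟩⟩
  · rintro C ⟨hd, hmap, hco⟩
    apply HopfCooperad.ext
    · funext I _
      apply Bidifferential.ext
      · refine R.eq_diff false _ (C.bidiff I).d_mul fun e i j hij => ?_
        rw [R.diff_gen]
        cases e
        · exact (hd I i j hij).1
        · exact (hd I i j hij).2.1
      · refine R.eq_diff true _ (C.bidiff I).dPrime_mul fun e i j hij => ?_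
        rw [R.diff_gen]
        cases e
        · exact (hd I i j hij).2.2.2
        · exact (hd I i j hij).2.2.1
    · funext I I' _ _ σ
      refine R.algHom_ext fun e i j hij => ?_
      refine Eq.trans ?_ (R.relabel_gen σ e i j).symm
      cases e
      · exact (hmap I I' σ i j hij).1
      · exact (hmap I I' σ i j hij).2
    · funext I J _ _
      obtain ⟨h1, h2, h3⟩ := hco I J
      have h4 : ∀ (e : Bool) (i : I) (j : J), C.cocomp I J (R.gen e (Sum.inl i) (Sum.inr j)) =
          R.cocomp I J (R.gen e (Sum.inl i) (Sum.inr j)) := by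
        intro e i j
        refine Eq.trans ?_ (R.cocomp_gen e _ _).symm
        cases e
        · exact (h3 i j).1
        · exact (h3 i j).2
      refine R.algHom_ext fun e x y hxy => ?_
      rcases x with i | j <;> rcases y with k | l
      · refine Eq.trans ?_ (R.cocomp_gen e _ _).symm
        have hik : i ≠ k := fun h => hxy (congrArg _ h)
        cases e
        · exact (h1 i k hik).1
        · exact (h1 i k hik).2
      · exact h4 e i l
      · rw [R.gen_swap e (Sum.inl k) (Sum.inr j), map_neg, map_neg]
        exact congrArg Neg.neg (h4 e k j)
      · refine Eq.trans ?_ (R.cocomp_gen e _ _).symm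
        have hjl : j ≠ l := fun h => hxy (congrArg _ h)
        cases e
        · exact (h2 j l hjl).1
        · exact (h2 j l hjl).2
    · refine R.algHom_ext fun e i j hij => ?_
      exact absurd (Subsingleton.elim i j) hij

end
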